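/- Let $F\in\mathbb{C}[y,p]$ be square-free with no non-constant factor in $\mathbb{C}[y]$ or in $\mathbb{C}[p]$, and let $y_0\in\mathbb{C}$ with $F(y_0,0)=0$. Put $$N=\max\bigl(2(\deg_pF-1)\deg_yF+1,\ \deg_yF+1\bigr).$$ **Solutions.** Let $\mathrm{Sol}(y_0)$ be the set of all formal Puiseux series at infinity $y(x)\in\bigcup_{n\ge1}\mathbb{C}((x^{-1/n}))$ with $F(y,y')=0$ (where $'=d/dx$), $y(\infty)=y_0$ and $y'(\infty)=0$; constant solutions are included. For a series $f=f_0+\sum_{j\ge k}c_j\tau^{j}$ with $k\ge1$ and $c_k\ne0$, its *first $N$ terms* are $f_0+\sum_{k\le j<k+N}c_j\tau^{j}$; a constant is its own truncation. For $y\in\mathrm{Sol}(y_0)$ this is taken with $\tau=x^{-1/n}$, where $n$ is the ramification order of $y$, i.e. the least $n\geq 1$ with $y\in\mathbb{C}((x^{-1/n}))$. **Parametrizations.** A formal parametrization at $(y_0,0)$ is a pair $(a,b)\in\mathbb{C}[[t]]^2$, not both constant, with $a(0)=y_0$, $b(0)=0$ and $F(a,b)=0$. Two of them are equivalent if one arises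 from the other by substituting a power series of order one for $t$. A formal parametrization is irreducible if it is not equivalent to a pair of series in $t^m$ for any $m>1$. It is classical Puiseux if it is irreducible and $a=y_0+t^k$ for some $k\ge1$. Let $R$ be any set of classical Puiseux parametrizations at $(y_0,0)$ containing exactly one member of each equivalence class of such parametrizations. **Algorithm PuiseuxSolveInfinity at $y_0$.** The output $\mathrm{ST}(y_0)$ consists of the constant $y_0$ and of the following truncations. For each $(a,b)\in R$ let $\hat a=a=y_0+t^k$, let $\hat b$ be the first $N$ terms of $b$, and let $r=\operatorname{ord}_t b$. Check whether $k-r=n(1-2)$ for some integer $n\ge1$, i.e. whether $n=r-k\ge1$. If so, solve the associated differential equation $$\hat a'(s(t))\,s'(t)=-n\,t^{-n-1}\,\hat b(s(t))$$ term by term (Newton polygon method) for the first $N$ terms $\hat s=\sigma_1t+\dots+\sigma_Nt^N$, $\sigma_1\neq0$. That is, in step $i=1,\dots,N$ choose $\sigma_i$ in all possible ways such that the coefficient of $t^{r+i-1}$ in $$t^{n+1}\,\hat a'(\hat s)\,\hat s'+n\,\hat b(\hat s)$$ with $\hat s=\sigma_1t+\dots+\sigma_it^i$ vanishes as well, so that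 this expression is divisible by $t^{r+i}$. A step may leave $\sigma_i$ as a free parameter, which then takes every value in $\mathbb{C}$; it may also have no solution, and then the branch is discarded. For every $\hat s$ so obtained, output the first $N$ terms of $\hat a(\hat s(t))$ at $t=x^{-1/n}$. **Claim.** Every $\tilde y\in\mathrm{ST}(y_0)$ extends to a solution: there is $y\in\mathrm{Sol}(y_0)$ whose first $N$ terms are $\tilde y$. Conversely, for every $y\in\mathrm{Sol}(y_0)$ its truncation to the first $N$ terms belongs to $\mathrm{ST}(y_0)$. -/

import Mathlib

/-! ## Formal Puiseux series expanded at infinity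

A formal Puiseux series at infinity is a Hahn series over `ℚ` in the variable `1/x`: the
coefficient at `g : ℚ` is the coefficient of `x ^ (-g)`.  So `single (1 / n) 1` is
`x ^ (-1 / n)`.  Polynomials `F(y, p)` are elements of `MvPolynomial (Fin 2) ℂ`, where
`X 0` is `y` and `X 1` is `p`. -/

namespace PuiseuxAtInfinity

/-- The exponents of `y` are multiples of `1 / n`, i.e. `y` lies in `ℂ((x ^ (-1 / n)))`. -/
def HasDenominator (n : ℕ) (y : HahnSeries ℚ ℂ) : Prop :=
  ∀ g ∈ y.support, ∃ j : ℤ, g = (j : ℚ) / (n : ℚ)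

/-- `y` is a formal Puiseux series at infinity: it lies in `ℂ((x ^ (-1 / n)))` for some
`n ≥ 1`. -/
def IsPuiseux (y : HahnSeries ℚ ℂ) : Prop :=
  ∃ n : ℕ, 0 < n ∧ HasDenominator n y

/-- The minimal `n ≥ 1` such that `y` lies in `ℂ((x ^ (-1 / n)))`. -/
noncomputable def ramificationOrder (y : HahnSeries ℚ ℂ) : ℕ :=
  sInf {n : ℕ | 0 < n ∧ HasDenominator n y}

/-- The derivative `d / dx`, which sends `x ^ (-g)` to `-g x ^ (-(g + 1))`. -/
def derivX (y : HahnSeries ℚ ℂ) : HahnSeries ℚ ℂ where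
  coeff g := -((g - 1 : ℚ) : ℂ) * y.coeff (g - 1)
  isPWO_support' := by
    refine (y.isPWO_support.image_of_monotone (f := fun g : ℚ => g + 1)
      (fun a b h => by simpa using h)).mono ?_
    intro g hg
    refine ⟨g - 1, ?_, by simp⟩
    rw [Function.mem_support] at hg
    exact right_ne_zero_of_mul hg

/-- `y` has the finite value `c` at `x = ∞`. -/
def HasValueAtInfinity (y : HahnSeries ℚ ℂ) (c : ℂ) : Prop :=
  (∀ g : ℚ, g < 0 → y.coeff g = 0) ∧ y.coeff 0 = c

/-- The formal Puiseux series solutions at infinity of `F(y, y') = 0` with initial tuple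
`(y(∞), y'(∞)) = (y₀, 0)`. -/
def solutions (F : MvPolynomial (Fin 2) ℂ) (y₀ : ℂ) : Set (HahnSeries ℚ ℂ) :=
  {y | IsPuiseux y ∧ MvPolynomial.aeval ![y, derivX y] F = 0 ∧
    HasValueAtInfinity y y₀ ∧ HasValueAtInfinity (derivX y) 0}

/-- The truncation of `y = y₀ + ∑_{j ≥ k} c_j x ^ (-j / n)` (`n` the ramification order,
`k ≥ 1`, `c_k ≠ 0`) to its first `N` terms beyond the constant one, namely
`y₀ + ∑_{k ≤ j < k + N} c_j x ^ (-j / n)`.  A constant is its own truncation. -/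
noncomputable def firstTermsAtInfinity (N : ℕ) (y : HahnSeries ℚ ℂ) : HahnSeries ℚ ℂ :=
  HahnSeries.C (y.coeff 0) +
    HahnSeries.truncLT
      ((y - HahnSeries.C (y.coeff 0)).order + (N : ℚ) / (ramificationOrder y : ℚ))
      (y - HahnSeries.C (y.coeff 0))

/-! ## Formal parametrizations and places at a finite point

A pair of formal Laurent series `(a(t), b(t))` with a value `(a(0), b(0))` in `ℂ²` is a pair
of formal power series, so parametrizations centered at a finite point are pairs of power
series. -/

/-- `A = (a, b)` is a formal parametrization of the curve `F = 0` centered at `p₀ ∈ ℂ²`. -/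
def IsParametrization (F : MvPolynomial (Fin 2) ℂ) (p₀ : ℂ × ℂ)
    (A : PowerSeries ℂ × PowerSeries ℂ) : Prop :=
  (¬ ∃ c d : ℂ, A = (PowerSeries.C c, PowerSeries.C d)) ∧
    PowerSeries.constantCoeff A.1 = p₀.1 ∧ PowerSeries.constantCoeff A.2 = p₀.2 ∧
    MvPolynomial.aeval ![A.1, A.2] F = 0

/-- `A(s(t)) = B(t)` for some formal power series `s` of order one. -/
def Equivalent (A B : PowerSeries ℂ × PowerSeries ℂ) : Prop :=
  ∃ s : PowerSeries ℂ, s.order = 1 ∧ PowerSeries.subst s A.1 = B.1 ∧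
    PowerSeries.subst s A.2 = B.2

/-- `f` is a power series in `t ^ m`. -/
def IsSeriesInPow (m : ℕ) (f : PowerSeries ℂ) : Prop :=
  ∀ i : ℕ, ¬ m ∣ i → PowerSeries.coeff i f = 0

/-- `A` is not equivalent to a pair of series in `t ^ m` with `m > 1`. -/
def IsIrreducible (A : PowerSeries ℂ × PowerSeries ℂ) : Prop :=
  ¬ ∃ m : ℕ, 1 < m ∧ ∃ B : PowerSeries ℂ × PowerSeries ℂ,
    Equivalent A B ∧ IsSeriesInPow m B.1 ∧ IsSeriesInPow m B.2

/-- A classical Puiseux parametrization centered at `p₀`: an irreducible formal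
parametrization of the form `(y₀ + t ^ k, b(t))` with `k ≥ 1`. -/
def IsClassicalPuiseux (F : MvPolynomial (Fin 2) ℂ) (p₀ : ℂ × ℂ)
    (A : PowerSeries ℂ × PowerSeries ℂ) : Prop :=
  IsParametrization F p₀ A ∧ IsIrreducible A ∧
    ∃ k : ℕ, 0 < k ∧ A.1 = PowerSeries.C p₀.1 + PowerSeries.X ^ k

/-- `R` consists of classical Puiseux parametrizations centered at `p₀`, one from each
equivalence class of such parametrizations (one for every place). -/
def IsRepresentativeSet (F : MvPolynomial (Fin 2) ℂ) (p₀ : ℂ × ℂ)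
    (R : Set (PowerSeries ℂ × PowerSeries ℂ)) : Prop :=
  (∀ A ∈ R, IsClassicalPuiseux F p₀ A) ∧
    ∀ B, IsClassicalPuiseux F p₀ B → ∃! A, A ∈ R ∧ Equivalent A B

/-! ## The algorithm at a point `(y₀, 0)` -/

/-- The truncation of `f = f₀ + ∑_{j ≥ k} c_j t ^ j` (`k ≥ 1`, `c_k ≠ 0`) to its first `N`
terms beyond the constant one, `f₀ + ∑_{k ≤ j < k + N} c_j t ^ j`. -/
noncomputable def firstTerms (N : ℕ) (f : PowerSeries ℂ) : Polynomial ℂ :=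
  Polynomial.C (PowerSeries.constantCoeff f) +
    PowerSeries.trunc
      ((f - PowerSeries.C (PowerSeries.constantCoeff f)).order.toNat + N)
      (f - PowerSeries.C (PowerSeries.constantCoeff f))

/-- The number of terms
`N = max (2 (deg_p F - 1) deg_y F + 1, deg_y F + 1)` used by the algorithm. -/
noncomputable def termBound (F : MvPolynomial (Fin 2) ℂ) : ℕ :=
  max (2 * (MvPolynomial.degreeOf 1 F - 1) * MvPolynomial.degreeOf 0 F + 1)
    (MvPolynomial.degreeOf 0 F + 1)

/-- The set of truncated parametrizations on which the algorithm works. -/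
noncomputable def truncatedParametrizations (N : ℕ)
    (R : Set (PowerSeries ℂ × PowerSeries ℂ)) : Set (Polynomial ℂ × Polynomial ℂ) :=
  (fun A => (firstTerms N A.1, firstTerms N A.2)) '' R

/-- The residual `t ^ (n + 1) * (a'(s) s' + n t ^ (-n - 1) b(s))` of the associated
differential equation `a'(s(t)) s'(t) = -n t ^ (-n - 1) b(s(t))`. -/
noncomputable def assocResidual (n : ℕ) (a b s : Polynomial ℂ) : Polynomial ℂ :=
  Polynomial.X ^ (n + 1) * ((Polynomial.derivative a).comp s * Polynomial.derivative s) +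
    (n : Polynomial ℂ) * b.comp s

/-- The Newton polygon method for the associated differential equation, with `b` of order
`r`.  `newtonApprox n r a b i` is the set of all `s = σ₁ t + ⋯ + σ_i t ^ i`, `σ₁ ≠ 0`, which
are found in `i` steps.  In each step one further term `σ t ^ (i + 1)` is computed, where `σ`
is any solution of the condition that the next coefficient of the residual, that of
`t ^ (r + i)`, vanishes.  A step may leave `σ` free, and it may have no solution; in the
latter case this branch is given up. -/
noncomputable def newtonApprox (n r : ℕ) (a b : Polynomial ℂ) : ℕ → Set (Polynomial ℂ)
  | 0 => {0}
  | i + 1 => {s | ∃ s₁ ∈ newtonApprox n r a b i, ∃ σ : ℂ, (i = 0 → σ ≠ 0) ∧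
      s = s₁ + Polynomial.C σ * Polynomial.X ^ (i + 1) ∧
      Polynomial.X ^ (r + i + 1) ∣ assocResidual n a b s}

/-- The truncations produced from one truncated parametrization `(a, b)` at `(y₀, 0)`.  With
`k = ord (a - y₀)` and `r = ord b` the algorithm checks that `n (1 - 2) = k - r` for some
`n ≥ 1`, computes the first `N` terms `s` of the solutions of the associated differential
equation, and puts out the first `N` terms of `a(s(t))` at `t = x ^ (-1 / n)`. -/
noncomputable def placeOutput (N : ℕ) (y₀ : ℂ) (a b : Polynomial ℂ) :
    Set (HahnSeries ℚ ℂ) :=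
  {w | ∃ n : ℕ, 0 < n ∧
    (n : ℤ) * (1 - 2) =
      ((a - Polynomial.C y₀).natTrailingDegree : ℤ) - (b.natTrailingDegree : ℤ) ∧
    ∃ s ∈ newtonApprox n b.natTrailingDegree a b N,
      w = Polynomial.aeval (HahnSeries.single (1 / (n : ℚ)) (1 : ℂ))
        (firstTerms N (a.comp s : Polynomial ℂ))}

/-- The output of the algorithm at `(y₀, 0)`, where `y₀` is a zero of `F(y, 0)`, for a
choice `R` of representatives: the constant solution `y₀` and the truncations produced from
the truncated representatives. -/
noncomputable def algorithmOutput (F : MvPolynomial (Fin 2) ℂ) (y₀ : ℂ)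
    (R : Set (PowerSeries ℂ × PowerSeries ℂ)) : Set (HahnSeries ℚ ℂ) :=
  {HahnSeries.C y₀} ∪
    ⋃ ab ∈ truncatedParametrizations (termBound F) R, placeOutput (termBound F) y₀ ab.1 ab.2

end PuiseuxAtInfinity

namespace PuiseuxAtInfinity

open PowerSeries

/-! ## Congruences between power series -/

/-! With `t = x^(-1/n)` one has `d/dx = -(1/n) t^(n+1) d/dt`. A nonconstant solution `Y(x^(-1/n))`
of ramification order `n` is therefore a parametrization `(Y, B)` of the curve with `n B = -t^(n+1)
Y'`. If `Y - y₀` has order `k`, then `B` has order `r = n + k`, which is why the algorithm reads off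
`n = r - k`.

From solutions to output: minimality of `n` makes `(Y, B)` irreducible
(`isIrreducible_of_solution`), so it is equivalent to a chosen representative `(y₀ + t^k, b)`. Thus
`Y = y₀ + s^k` and `B = b(s)` with `s` of order one, and the relation above becomes the associated
equation for `s`. The truncations of `s` pass every Newton step (`trunc_mem_newtonApprox`).

From output to solutions: in the associated equation the coefficient `σ_{i+1}` first appears
linearly, with a factor proportional to `i - n`, so `σ_{n+1}` is the only resonant coefficient.
Counting conjugates gives `n + k = r ≤ deg_y F` (`order_le_degreeOf`), hence `n < N`: the resonance
lies among the computed terms, where the algorithm itself has tested solvability, and every later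
coefficient can be found (`exists_assocSeries_eq_zero`). Irreducibility of the place shows that the
resulting series has ramification order exactly `n`, so that both sides truncate at the same
exponent. -/

theorem X_dvd_of_order_eq_one {s : ℂ⟦X⟧} (hs : s.order = 1) : X ∣ s := by
  rw [← pow_one (X : ℂ⟦X⟧), X_pow_dvd_iff]
  intro m hm
  exact coeff_of_lt_order m (by rw [hs]; exact_mod_cast hm)

theorem order_eq_one_iff {s : ℂ⟦X⟧} : s.order = 1 ↔ X ∣ s ∧ coeff 1 s ≠ 0 := by
  constructor
  · intro h
    refine ⟨X_dvd_of_order_eq_one h, ?_⟩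
    have := (order_eq_nat (φ := s) (n := 1)).1 (by exact_mod_cast h)
    exact this.1
  · rintro ⟨h, h1⟩
    have : s.order = ((1 : ℕ) : ℕ∞) := by
      rw [order_eq_nat]
      refine ⟨h1, fun i hi => ?_⟩
      rw [← pow_one (X : ℂ⟦X⟧), X_pow_dvd_iff] at h
      exact h i hi
    exact_mod_cast this

theorem hasSubst_of_X_dvd {s : ℂ⟦X⟧} (hs : X ∣ s) : HasSubst s :=
  HasSubst.of_constantCoeff_zero' (X_dvd_iff.1 hs)

theorem X_pow_dvd_subst_sub_subst {s s' : ℂ⟦X⟧} (hs : X ∣ s) (hs' : X ∣ s') {j : ℕ}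
    (h : X ^ j ∣ s' - s) (f : ℂ⟦X⟧) : X ^ j ∣ subst s' f - subst s f := by
  rw [X_pow_dvd_iff]
  intro m hm
  rw [map_sub, coeff_subst' (hasSubst_of_X_dvd hs), coeff_subst' (hasSubst_of_X_dvd hs'),
    sub_eq_zero]
  refine finsum_congr fun d => ?_
  have := X_pow_dvd_iff.1 (h.trans (sub_dvd_pow_sub_pow s' s d)) m hm
  rw [map_sub, sub_eq_zero] at this
  rw [this]

theorem subst_mul_of_X_dvd {s : ℂ⟦X⟧} (hs : X ∣ s) (f g : ℂ⟦X⟧) :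
    (subst s (f * g) : ℂ⟦X⟧) = (subst s f : ℂ⟦X⟧) * (subst s g : ℂ⟦X⟧) :=
  subst_mul (hasSubst_of_X_dvd hs) f g

theorem subst_pow_of_X_dvd {s : ℂ⟦X⟧} (hs : X ∣ s) (f : ℂ⟦X⟧) (n : ℕ) :
    (subst s (f ^ n) : ℂ⟦X⟧) = (subst s f : ℂ⟦X⟧) ^ n :=
  subst_pow (hasSubst_of_X_dvd hs) f n

theorem subst_X_of_X_dvd {s : ℂ⟦X⟧} (hs : X ∣ s) : (subst s (X : ℂ⟦X⟧) : ℂ⟦X⟧) = s :=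
  subst_X (hasSubst_of_X_dvd hs)

theorem subst_zero_of_X_dvd {s : ℂ⟦X⟧} (hs : X ∣ s) : (subst s (0 : ℂ⟦X⟧) : ℂ⟦X⟧) = 0 := by
  rw [← coe_substAlgHom (hasSubst_of_X_dvd hs)]
  exact map_zero _

theorem X_dvd_subst {s f : ℂ⟦X⟧} (hs : X ∣ s) (hf : X ∣ f) : X ∣ subst s f := by
  obtain ⟨g, rfl⟩ := hf
  rw [subst_mul_of_X_dvd hs, subst_X_of_X_dvd hs]
  exact hs.mul_right _

theorem X_pow_dvd_subst {s f : ℂ⟦X⟧} (hs : X ∣ s) {j : ℕ} (hf : X ^ j ∣ f) :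
    X ^ j ∣ subst s f := by
  obtain ⟨g, rfl⟩ := hf
  rw [subst_mul_of_X_dvd hs, subst_pow_of_X_dvd hs, subst_X_of_X_dvd hs]
  exact (pow_dvd_pow_of_dvd hs j).mul_right _

theorem constantCoeff_subst_of_X_dvd {s : ℂ⟦X⟧} (hs : X ∣ s) (f : ℂ⟦X⟧) :
    constantCoeff (subst s f) = constantCoeff f := by
  have h : f = C (constantCoeff f) + (f - C (constantCoeff f)) := by ring
  have h2 : X ∣ subst s (f - C (constantCoeff f)) :=
    X_dvd_subst hs (X_dvd_iff.2 (by simp))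
  have h3 : subst s (C (constantCoeff f)) = (C (constantCoeff f) : ℂ⟦X⟧) := subst_C _
  conv_lhs => rw [h]
  rw [subst_add (hasSubst_of_X_dvd hs), map_add, X_dvd_iff.1 h2, h3]
  simp

theorem exists_eq_X_mul {s : ℂ⟦X⟧} (hs : X ∣ s) :
    ∃ p : ℂ⟦X⟧, s = X * p ∧ constantCoeff p = coeff 1 s := by
  obtain ⟨p, rfl⟩ := hs
  refine ⟨p, rfl, ?_⟩
  rw [show (1 : ℕ) = 0 + 1 from rfl, coeff_succ_X_mul]
  simp

theorem coeff_eq_of_X_pow_dvd_sub {s s' : ℂ⟦X⟧} {j m : ℕ} (h : X ^ j ∣ s' - s) (hm : m < j) :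
    coeff m s' = coeff m s := by
  have := X_pow_dvd_iff.1 h m hm
  rwa [map_sub, sub_eq_zero] at this

theorem X_dvd_of_X_pow_dvd_sub {s s' : ℂ⟦X⟧} {j : ℕ} (h : X ^ (j + 1) ∣ s' - s) (hs : X ∣ s) :
    X ∣ s' := by
  have h1 : X ∣ s' - s := (dvd_pow_self X (Nat.succ_ne_zero j)).trans h
  simpa using dvd_add h1 hs

/-- Writing `s = X p`, a change of `s` from order `i + 1` on is a change of `p` from order `i` on,
and the factor `X^m` comes out of the power. -/
theorem X_pow_dvd_pow_sub_pow {s s' : ℂ⟦X⟧} (hs : X ∣ s) {i : ℕ}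
    (h : X ^ (i + 1) ∣ s' - s) (m : ℕ) : X ^ (m + i) ∣ s' ^ m - s ^ m := by
  have hs' := X_dvd_of_X_pow_dvd_sub h hs
  obtain ⟨p, rfl⟩ := hs
  obtain ⟨p', rfl⟩ := hs'
  have h2 : X ^ i ∣ p' - p := by
    have : (X : ℂ⟦X⟧) * X ^ i ∣ X * (p' - p) := by
      convert h using 1 <;> ring
    exact (mul_dvd_mul_iff_left X_ne_zero).1 this
  rw [mul_pow, mul_pow, ← mul_sub, pow_add]
  exact mul_dvd_mul_left _ (h2.trans (sub_dvd_pow_sub_pow _ _ _))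

theorem X_dvd_sub_C {f : ℂ⟦X⟧} : X ∣ f - C (constantCoeff f) :=
  X_dvd_iff.2 (by simp)

/-- First-order Taylor expansion. The quadratic remainder has order at least `m + 2i`, which is at
least `m + i + 1` because `i ≥ 1`. -/
theorem X_pow_dvd_pow_perturb {s : ℂ⟦X⟧} (hs : X ∣ s) {i : ℕ} (hi : 1 ≤ i) (m : ℕ) (σ : ℂ) :
    X ^ (m + i + 1) ∣ (s + C σ * X ^ (i + 1)) ^ m - s ^ m -
      C (m * coeff 1 s ^ (m - 1) * σ) * X ^ (m + i) := by
  obtain ⟨p, rfl, hp⟩ := exists_eq_X_mul hs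
  rw [← hp]
  obtain ⟨e, he⟩ := Polynomial.powAddExpansion p (C σ * X ^ i) m
  obtain ⟨q, hq⟩ : X ∣ p ^ (m - 1) - C (constantCoeff p ^ (m - 1)) := by
    simpa using X_dvd_sub_C (f := p ^ (m - 1))
  obtain ⟨l, rfl⟩ := Nat.exists_eq_add_of_le hi
  have h1 : X * p + C σ * X ^ (1 + l + 1) = X * (p + C σ * X ^ (1 + l)) := by ring
  rw [h1, mul_pow, he]
  rw [sub_eq_iff_eq_add] at hq
  rw [hq]
  refine ⟨(m : ℂ⟦X⟧) * q * C σ + e * C σ ^ 2 * X ^ l, ?_⟩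
  have h2 : (C (m * constantCoeff p ^ (m - 1) * σ) : ℂ⟦X⟧) =
    m * C (constantCoeff p ^ (m - 1)) * C σ := by simp
  rw [h2]
  ring

/-- Only the leading term of `f = X^r g` matters: `g(s)` changes from order `i + 1` on and is
multiplied by a series of order at least `r`. -/
theorem X_pow_dvd_subst_perturb {s f : ℂ⟦X⟧} (hs : X ∣ s) {i r : ℕ} (hi : 1 ≤ i)
    (hf : X ^ r ∣ f) (σ : ℂ) :
    X ^ (r + i + 1) ∣ subst (s + C σ * X ^ (i + 1)) f - subst s f -
      C (coeff r f * (r * coeff 1 s ^ (r - 1) * σ)) * X ^ (r + i) := by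
  set s' := s + C σ * X ^ (i + 1) with hs'
  have hd : X ^ (i + 1) ∣ s' - s := ⟨C σ, by rw [hs']; ring⟩
  have hX' := X_dvd_of_X_pow_dvd_sub hd hs
  obtain ⟨g, rfl⟩ := hf
  have hg : coeff r (X ^ r * g) = constantCoeff g := by
    have := coeff_X_pow_mul g r 0
    simpa using this
  rw [hg]
  have e1 : ∀ u : ℂ⟦X⟧, X ∣ u → subst u (X ^ r * g) = u ^ r * subst u g := fun u hu => by
    rw [subst_mul_of_X_dvd hu, subst_pow_of_X_dvd hu, subst_X_of_X_dvd hu]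
  rw [e1 s hs, e1 s' hX']
  obtain ⟨u, hu⟩ := X_pow_dvd_pow_perturb hs hi r σ
  obtain ⟨v, hv⟩ := X_pow_dvd_subst_sub_subst hs hX' hd g
  obtain ⟨w, hw⟩ : X ∣ subst s g - C (constantCoeff g) := by
    have := X_dvd_sub_C (f := subst s g)
    rwa [constantCoeff_subst_of_X_dvd hs] at this
  obtain ⟨z, hz⟩ := pow_dvd_pow_of_dvd hX' r
  rw [← hs'] at hu
  have e2 : s' ^ r * subst s' g - s ^ r * subst s g =
    (s' ^ r - s ^ r) * subst s g + s' ^ r * (subst s' g - subst s g) := by ring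
  rw [sub_eq_iff_eq_add] at hu hw
  rw [e2, hv, hu, hw, hz]
  simp only [map_mul]
  refine ⟨u * (X * w + C (constantCoeff g)) +
    C (r : ℂ) * C (coeff 1 s ^ (r - 1)) * C σ * w + z * v, ?_⟩
  ring

theorem X_pow_dvd_subst_congr {s s' f : ℂ⟦X⟧} (hs : X ∣ s) {i r : ℕ}
    (h : X ^ (i + 1) ∣ s' - s) (hf : X ^ r ∣ f) : X ^ (r + i) ∣ subst s' f - subst s f := by
  have hX' := X_dvd_of_X_pow_dvd_sub h hs
  obtain ⟨g, rfl⟩ := hf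
  have e1 : ∀ u : ℂ⟦X⟧, X ∣ u → subst u (X ^ r * g) = u ^ r * subst u g := fun u hu => by
    rw [subst_mul_of_X_dvd hu, subst_pow_of_X_dvd hu, subst_X_of_X_dvd hu]
  rw [e1 s hs, e1 s' hX']
  have e2 : s' ^ r * subst s' g - s ^ r * subst s g =
    (s' ^ r - s ^ r) * subst s g + s' ^ r * (subst s' g - subst s g) := by ring
  rw [e2]
  refine dvd_add ((X_pow_dvd_pow_sub_pow hs h r).mul_right _) ?_
  rw [pow_add]
  exact mul_dvd_mul (pow_dvd_pow_of_dvd hX' r)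
    ((pow_dvd_pow X (Nat.le_succ i)).trans (X_pow_dvd_subst_sub_subst hs hX' h g))

theorem X_pow_dvd_derivative {f : ℂ⟦X⟧} {j : ℕ} (h : X ^ (j + 1) ∣ f) : X ^ j ∣ d⁄dX ℂ f := by
  rw [X_pow_dvd_iff] at h ⊢
  intro m hm
  rw [coeff_derivative, h (m + 1) (by omega), zero_mul]

theorem eq_zero_of_forall_X_pow_dvd {f : ℂ⟦X⟧} {j : ℕ} (h : ∀ i, X ^ (j + i) ∣ f) : f = 0 := by
  ext m
  exact X_pow_dvd_iff.1 (h (m + 1)) m (by omega)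

/-! ### Successive approximation: roots and compositional inverses -/

/-- Solving an equation in power series coefficient by coefficient. -/
theorem exists_zero_of_step (E : ℂ⟦X⟧ → ℂ⟦X⟧) (q i₀ : ℕ) (s₀ : ℂ⟦X⟧)
    (h₀ : X ^ (q + i₀) ∣ E s₀)
    (hcongr : ∀ i ≥ i₀, ∀ s s', X ^ (i₀ + 1) ∣ s - s₀ → X ^ (i + 1) ∣ s' - s →
      X ^ (q + i) ∣ E s' - E s)
    (hstep : ∀ i ≥ i₀, ∀ s, X ^ (i₀ + 1) ∣ s - s₀ → X ^ (q + i) ∣ E s →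
      ∃ σ : ℂ, X ^ (q + i + 1) ∣ E (s + C σ * X ^ (i + 1))) :
    ∃ s, E s = 0 ∧ X ^ (i₀ + 1) ∣ s - s₀ := by
  have step : ∀ (j : ℕ) (s : {s : ℂ⟦X⟧ // X ^ (i₀ + 1) ∣ s - s₀ ∧ X ^ (q + (i₀ + j)) ∣ E s}),
      ∃ s' : {s : ℂ⟦X⟧ // X ^ (i₀ + 1) ∣ s - s₀ ∧ X ^ (q + (i₀ + (j + 1))) ∣ E s},
        X ^ (i₀ + j + 1) ∣ s'.1 - s.1 := by
    rintro j ⟨s, h1, h2⟩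
    obtain ⟨σ, hσ⟩ := hstep (i₀ + j) (by omega) s h1 h2
    refine ⟨⟨s + C σ * X ^ (i₀ + j + 1), ?_, hσ⟩, ⟨C σ, by ring⟩⟩
    rw [add_sub_right_comm]
    exact dvd_add h1 ((pow_dvd_pow X (by omega)).mul_left _)
  choose next hnext using step
  let S : ∀ j : ℕ, {s : ℂ⟦X⟧ // X ^ (i₀ + 1) ∣ s - s₀ ∧ X ^ (q + (i₀ + j)) ∣ E s} :=
    fun j => Nat.rec ⟨s₀, by simp, h₀⟩ (fun j s => next j s) j
  have hS : ∀ j, X ^ (i₀ + j + 1) ∣ (S (j + 1)).1 - (S j).1 := fun j => hnext j (S j)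
  have hS' : ∀ j d, X ^ (i₀ + j + 1) ∣ (S (j + d)).1 - (S j).1 := by
    intro j d
    induction d with
    | zero => simp
    | succ d ih =>
      have := dvd_add ((pow_dvd_pow X (by omega : i₀ + j + 1 ≤ i₀ + (j + d) + 1)).trans
        (hS (j + d))) ih
      rwa [sub_add_sub_cancel] at this
  -- Diagonal limit: the coefficient at `m` no longer changes after the approximant `S m`, which is
  -- correct below `i₀ + m + 1`.
  let s : ℂ⟦X⟧ := mk fun m => coeff m (S m).1
  have hs : ∀ j, X ^ (i₀ + j + 1) ∣ s - (S j).1 := by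
    intro j
    rw [X_pow_dvd_iff]
    intro m hm
    rw [map_sub, coeff_mk, sub_eq_zero]
    rcases le_total j m with h | h
    · obtain ⟨d, rfl⟩ := Nat.exists_eq_add_of_le h
      exact coeff_eq_of_X_pow_dvd_sub (hS' j d) hm
    · obtain ⟨d, rfl⟩ := Nat.exists_eq_add_of_le h
      exact (coeff_eq_of_X_pow_dvd_sub (hS' m d) (by omega)).symm
  refine ⟨s, ?_, hs 0⟩
  refine eq_zero_of_forall_X_pow_dvd (j := q + i₀) fun j => ?_
  have h1 := hcongr (i₀ + j) (by omega) (S j).1 s (S j).2.1 (hs j)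
  have h2 := dvd_add h1 (S j).2.2
  simpa [add_assoc] using h2

/-- A power series of order `k ≥ 1` is the `k`-th power of a power series of order one. -/
theorem exists_pow_eq {f : ℂ⟦X⟧} {k : ℕ} (hk : 0 < k) (hf : f.order = k) :
    ∃ s : ℂ⟦X⟧, s.order = 1 ∧ s ^ k = f := by
  rw [order_eq_nat] at hf
  obtain ⟨hf1, hf0⟩ := hf
  obtain ⟨c, hc⟩ := IsAlgClosed.exists_pow_nat_eq (coeff k f) hk
  have hc0 : c ≠ 0 := by
    rintro rfl
    rw [zero_pow hk.ne'] at hc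
    exact hf1 hc.symm
  have hX : X ∣ C c * X := dvd_mul_left _ _
  have h1 : coeff 1 (C c * X : ℂ⟦X⟧) = c := by simp
  -- Start from `c X`, where `c^k` is the leading coefficient of `f`. The linear coefficient in
  -- every later step is `k c^(k-1)`, which is nonzero.
  obtain ⟨s, hs, hs'⟩ := exists_zero_of_step (fun s => s ^ k - f) k 1 (C c * X) (by
      rw [X_pow_dvd_iff]
      intro m hm
      have e : (C c * X : ℂ⟦X⟧) ^ k = C (c ^ k) * X ^ k := by rw [mul_pow, map_pow]
      rw [map_sub, e, coeff_C_mul, coeff_X_pow, hc]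
      split_ifs with h
      · simp [h]
      · simp [hf0 m (by omega)])
    (by
      intro i _ s s' h h'
      have hXs := X_dvd_of_X_pow_dvd_sub h hX
      simpa using X_pow_dvd_pow_sub_pow hXs h' k)
    (by
      intro i hi s h h'
      have hXs := X_dvd_of_X_pow_dvd_sub h hX
      have hc1 : coeff 1 s = c := by rw [coeff_eq_of_X_pow_dvd_sub h (by omega), h1]
      obtain ⟨e, he⟩ := h'
      have hL : (k : ℂ) * c ^ (k - 1) ≠ 0 :=
        mul_ne_zero (by exact_mod_cast hk.ne') (pow_ne_zero _ hc0)
      refine ⟨-constantCoeff e / (k * c ^ (k - 1)), ?_⟩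
      obtain ⟨u, hu⟩ := X_pow_dvd_pow_perturb hXs hi k (-constantCoeff e / (k * c ^ (k - 1)))
      rw [hc1, mul_div_cancel₀ _ hL] at hu
      obtain ⟨v, hv⟩ := X_dvd_sub_C (f := e)
      refine ⟨u + v, ?_⟩
      rw [sub_eq_iff_eq_add] at he hu hv
      rw [sub_eq_iff_eq_add] at hu
      rw [hu, he]
      have : e = X * v + C (constantCoeff e) := hv
      conv_lhs => rw [this]
      simp only [map_neg, map_add, map_mul]
      simp
      ring)
  refine ⟨s, order_eq_one_iff.2 ⟨X_dvd_of_X_pow_dvd_sub hs' hX, ?_⟩, sub_eq_zero.1 hs⟩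
  rw [coeff_eq_of_X_pow_dvd_sub hs' (by omega), h1]
  exact hc0

/-- Power series of order one are invertible under composition. -/
theorem exists_subst_inverse {s : ℂ⟦X⟧} (hs : s.order = 1) :
    ∃ w : ℂ⟦X⟧, w.order = 1 ∧ subst w s = X ∧ subst s w = X := by
  obtain ⟨h0, h1⟩ := order_eq_one_iff.1 hs
  have hu : IsUnit (coeff 1 s) := isUnit_iff_ne_zero.2 h1
  have h0' := X_dvd_iff.1 h0
  refine ⟨substInvOfIsUnit s hu, order_eq_one_iff.2 ⟨X_dvd_iff.2 ?_, ?_⟩, ?_, ?_⟩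
  · exact constantCoeff_substInvOfIsUnit _ _
  · rw [coeff_one_substInvOfIsUnit]
    exact Units.ne_zero _
  · exact subst_substInvOfIsUnit_right _ h0' hu
  · exact subst_substInvOfIsUnit_left _ h0' hu

theorem subst_subst {a b : ℂ⟦X⟧} (ha : X ∣ a) (hb : X ∣ b) (f : ℂ⟦X⟧) :
    subst b (subst a f) = subst (subst b a) f :=
  subst_comp_subst_apply (hasSubst_of_X_dvd ha) (hasSubst_of_X_dvd hb) f

theorem order_subst {f s : ℂ⟦X⟧} (hs : s.order = 1) :
    PowerSeries.order (subst s f : ℂ⟦X⟧) = f.order := by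
  by_cases hf : f = 0
  · subst hf
    rw [subst_zero_of_X_dvd (X_dvd_of_order_eq_one hs)]
  have h0 := X_dvd_of_order_eq_one hs
  have hu : PowerSeries.order (subst s f.divXPowOrder : ℂ⟦X⟧) = 0 := by
    apply order_zero_of_unit
    rw [isUnit_iff_constantCoeff, constantCoeff_subst_of_X_dvd h0, isUnit_iff_ne_zero]
    rwa [Ne, constantCoeff_divXPowOrder_eq_zero_iff]
  conv_lhs => rw [← X_pow_order_mul_divXPowOrder (f := f)]
  rw [subst_mul_of_X_dvd h0, subst_pow_of_X_dvd h0, subst_X_of_X_dvd h0, order_mul, order_pow,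
    hs, hu, add_zero, nsmul_one, ENat.natCast_toNat (order_eq_top.not.2 hf)]

theorem map_aeval_pair {S T : Type*} [CommRing S] [CommRing T] [Algebra ℂ S] [Algebra ℂ T]
    (φ : S →ₐ[ℂ] T) (a b : S) (F : MvPolynomial (Fin 2) ℂ) :
    φ (MvPolynomial.aeval ![a, b] F) = MvPolynomial.aeval ![φ a, φ b] F := by
  have h : ![φ a, φ b] = fun i => φ (![a, b] i) := by
    funext i
    fin_cases i <;> rfl
  rw [h, ← MvPolynomial.comp_aeval_apply]

/-- Substitution commutes with the evaluation of polynomials. -/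
theorem aeval_subst {s : ℂ⟦X⟧} (hs : X ∣ s) (a b : ℂ⟦X⟧) (F : MvPolynomial (Fin 2) ℂ) :
    MvPolynomial.aeval ![(subst s a : ℂ⟦X⟧), (subst s b : ℂ⟦X⟧)] F =
      (subst s (MvPolynomial.aeval ![a, b] F) : ℂ⟦X⟧) := by
  let φ : ℂ⟦X⟧ →ₐ[ℂ] ℂ⟦X⟧ := substAlgHom (hasSubst_of_X_dvd hs)
  have hφ : ∀ f, φ f = subst s f := fun f => by
    rw [← coe_substAlgHom (hasSubst_of_X_dvd hs)]
  rw [← hφ, ← hφ, ← hφ, map_aeval_pair]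

/-! ## Equivalence and irreducibility of parametrizations -/

theorem Equivalent.symm {A B : ℂ⟦X⟧ × ℂ⟦X⟧} (h : Equivalent A B) : Equivalent B A := by
  obtain ⟨s, hs, h1, h2⟩ := h
  obtain ⟨w, hw, h3, h4⟩ := exists_subst_inverse hs
  have e : ∀ f : ℂ⟦X⟧, subst w (subst s f : ℂ⟦X⟧) = f := fun f => by
    rw [subst_subst (X_dvd_of_order_eq_one hs) (X_dvd_of_order_eq_one hw), h3, X_subst]
  exact ⟨w, hw, by rw [← h1, e], by rw [← h2, e]⟩

theorem Equivalent.trans {A B D : ℂ⟦X⟧ × ℂ⟦X⟧} (h : Equivalent A B) (h' : Equivalent B D) :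
    Equivalent A D := by
  obtain ⟨s, hs, h1, h2⟩ := h
  obtain ⟨w, hw, h3, h4⟩ := h'
  have := X_dvd_of_order_eq_one hs
  have := X_dvd_of_order_eq_one hw
  refine ⟨subst w s, (order_subst hw).trans hs, ?_, ?_⟩
  · rw [← subst_subst ‹_› ‹_›, h1, h3]
  · rw [← subst_subst ‹_› ‹_›, h2, h4]

theorem IsIrreducible.of_equivalent {A B : ℂ⟦X⟧ × ℂ⟦X⟧} (hB : IsIrreducible B)
    (h : Equivalent A B) : IsIrreducible A := by
  rintro ⟨m, hm, D, hD, h1⟩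
  exact hB ⟨m, hm, D, h.symm.trans hD, h1⟩

/-! ### Rotations `t ↦ ζ t` and irreducibility -/

theorem isSeriesInPow_iff_rescale {m : ℕ} {ζ : ℂ} (hζ : IsPrimitiveRoot ζ m) (f : ℂ⟦X⟧) :
    IsSeriesInPow m f ↔ rescale ζ f = f := by
  constructor
  · intro h
    ext i
    rw [coeff_rescale]
    by_cases hi : m ∣ i
    · rw [(hζ.pow_eq_one_iff_dvd i).2 hi, one_mul]
    · rw [h i hi, mul_zero]
  · intro h i hi
    have h1 := congrArg (coeff i) h
    rw [coeff_rescale] at h1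
    by_contra h0
    exact hi ((hζ.pow_eq_one_iff_dvd i).1 (mul_right_cancel₀ h0 (by rw [h1, one_mul])))

theorem X_mul_derivative_rescale (ζ : ℂ) (f : ℂ⟦X⟧) :
    X * d⁄dX ℂ (rescale ζ f) = rescale ζ (X * d⁄dX ℂ f) := by
  ext i
  rw [coeff_rescale]
  cases i with
  | zero => simp
  | succ i =>
    rw [coeff_succ_X_mul, coeff_succ_X_mul, coeff_derivative, coeff_derivative, coeff_rescale]
    ring

theorem constantCoeff_derivative (f : ℂ⟦X⟧) : constantCoeff (d⁄dX ℂ f) = coeff 1 f := by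
  rw [← coeff_zero_eq_constantCoeff_apply, coeff_derivative]
  simp

/-- If the differential form `w ^ (-n - 1) dw` is invariant under `t ↦ ζ t`, then this rotation
acts on `w` as multiplication by `ζ`, and `ζ ^ n = 1`. -/
theorem rescale_eq_of_invariant_form {w : ℂ⟦X⟧} (hw : w.order = 1) {ζ : ℂ} (hζ : ζ ≠ 0) {n : ℕ}
    (h : X * d⁄dX ℂ w * rescale ζ w ^ (n + 1) = X * d⁄dX ℂ (rescale ζ w) * w ^ (n + 1)) :
    ζ ^ n = 1 ∧ rescale ζ w = C ζ * w := by
  obtain ⟨hX, h1⟩ := order_eq_one_iff.1 hw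
  obtain ⟨p, hp, hp0⟩ := exists_eq_X_mul hX
  have hX' : X ∣ rescale ζ w := by
    rw [X_dvd_iff, ← coeff_zero_eq_constantCoeff_apply, coeff_rescale, pow_zero, one_mul,
      coeff_zero_eq_constantCoeff_apply, X_dvd_iff.1 hX]
  obtain ⟨p', hp', hp0'⟩ := exists_eq_X_mul hX'
  have hc' : coeff 1 (rescale ζ w) = ζ * coeff 1 w := by simp [coeff_rescale]
  rw [hc'] at hp0'
  -- Compare the coefficients of `t^(n+2)` in `h`: `ζ^(n+1) = ζ`.
  have hζn : ζ ^ n = 1 := by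
    have e : X ^ (n + 2) * (d⁄dX ℂ w * p' ^ (n + 1)) =
        X ^ (n + 2) * (d⁄dX ℂ (rescale ζ w) * p ^ (n + 1)) := by
      have e1 : (X : ℂ⟦X⟧) ^ (n + 2) * (d⁄dX ℂ w * p' ^ (n + 1)) =
        X * d⁄dX ℂ w * (X * p') ^ (n + 1) := by ring
      have e2 : (X : ℂ⟦X⟧) ^ (n + 2) * (d⁄dX ℂ (rescale ζ w) * p ^ (n + 1)) =
        X * d⁄dX ℂ (rescale ζ w) * (X * p) ^ (n + 1) := by ring
      rw [e1, e2, ← hp, ← hp', h]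
    have e3 := congrArg constantCoeff (mul_left_cancel₀ (pow_ne_zero _ X_ne_zero) e)
    simp only [map_mul, map_pow, constantCoeff_derivative, hp0, hp0', hc'] at e3
    have hne : ζ * coeff 1 w ^ (n + 2) ≠ 0 := mul_ne_zero hζ (pow_ne_zero _ h1)
    refine mul_left_cancel₀ hne ?_
    linear_combination e3
  refine ⟨hζn, ?_⟩
  -- Since `ζ^(n+1) = ζ`, the series `ζ w` satisfies the same equation as the rotated `w`. If their
  -- difference `f` is nonzero of order `e`, the leading coefficients of the subtracted equations
  -- give `e = n + 1`. But the coefficient of `f` at `n + 1` is `(ζ^(n+1) - ζ)` times that of `w`,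
  -- hence zero.
  by_contra hne
  have hf : rescale ζ w - C ζ * w ≠ 0 := sub_ne_zero.2 hne
  set f := rescale ζ w - C ζ * w with hfdef
  set e := f.order.toNat with he
  set g := f.divXPowOrder with hg
  have hfg : X ^ e * g = f := X_pow_order_mul_divXPowOrder
  have hg0 : constantCoeff g ≠ 0 := by
    rwa [Ne, hg, constantCoeff_divXPowOrder_eq_zero_iff]
  have hθf : X * d⁄dX ℂ f = X ^ e * ((e : ℂ⟦X⟧) * g + X * d⁄dX ℂ g) := by
    rw [← hfg, Derivation.leibniz, derivative_pow, derivative_X]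
    rcases e with _ | e
    · simp
    · simp only [smul_eq_mul, Nat.add_sub_cancel, mul_one]
      ring
  have hθ : X * d⁄dX ℂ (rescale ζ w) = X * d⁄dX ℂ f + C ζ * (X * d⁄dX ℂ w) := by
    have : rescale ζ w = f + C ζ * w := by rw [hfdef]; ring
    rw [this, map_add, Derivation.leibniz]
    simp
    ring
  have hζn' : (C ζ : ℂ⟦X⟧) ^ (n + 1) = C ζ := by rw [← map_pow, pow_succ, hζn, one_mul]
  have hgs := geom_sum₂_mul p' (C ζ * p) (n + 1)
  set S := ∑ i ∈ Finset.range (n + 1), p' ^ i * (C ζ * p) ^ (n + 1 - 1 - i) with hS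
  have hS0 : constantCoeff S = (n + 1) * (ζ * coeff 1 w) ^ n := by
    have := geom_sum₂_self (ζ * coeff 1 w) (n + 1)
    rw [hS, map_sum]
    simp only [map_mul, map_pow, hp0, hp0', constantCoeff_C]
    rw [this]
    simp
  have hXf : X * (p' - C ζ * p) = X ^ e * g := by
    rw [hfg, hfdef]
    conv_rhs => rw [hp', hp]
    ring
  have hmain : X ^ (n + 1 + e) * (d⁄dX ℂ w * S * g) =
      X ^ (n + 1 + e) * (((e : ℂ⟦X⟧) * g + X * d⁄dX ℂ g) * p ^ (n + 1)) := by
    have e1 : X * d⁄dX ℂ w * (rescale ζ w ^ (n + 1) - (C ζ * w) ^ (n + 1)) =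
        X * d⁄dX ℂ f * w ^ (n + 1) := by
      rw [mul_pow, hζn', mul_sub, h, hθ]
      ring
    have e2 : rescale ζ w ^ (n + 1) - (C ζ * w) ^ (n + 1) =
        X ^ (n + 1) * (S * (p' - C ζ * p)) := by
      rw [hgs, hp']
      conv_lhs => rw [hp]
      ring
    rw [e2, hθf] at e1
    have e3 : w ^ (n + 1) = X ^ (n + 1) * p ^ (n + 1) := by rw [← mul_pow, ← hp]
    rw [e3] at e1
    calc X ^ (n + 1 + e) * (d⁄dX ℂ w * S * g)
        = X ^ (n + 1) * d⁄dX ℂ w * S * (X ^ e * g) := by ring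
      _ = X * d⁄dX ℂ w * (X ^ (n + 1) * (S * (p' - C ζ * p))) := by rw [← hXf]; ring
      _ = _ := by rw [e1]; ring
  have hcc := congrArg constantCoeff (mul_left_cancel₀ (pow_ne_zero _ X_ne_zero) hmain)
  simp only [map_mul, map_pow, map_add, constantCoeff_derivative, hp0, hS0, constantCoeff_X,
    zero_mul, add_zero, map_natCast, mul_pow, hζn, one_mul] at hcc
  have hen : (e : ℂ) = n + 1 := by
    have hne' : constantCoeff g * coeff 1 w ^ (n + 1) ≠ 0 := mul_ne_zero hg0 (pow_ne_zero _ h1)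
    refine mul_left_cancel₀ hne' ?_
    linear_combination -hcc
  have hen' : e = n + 1 := by exact_mod_cast hen
  have hz : coeff e f = 0 := by
    rw [hfdef, map_sub, coeff_rescale, coeff_C_mul, hen', pow_succ, hζn]
    ring
  exact coeff_order hf hz

/-- A parametrization `(y(t), y'(t))` coming from a Puiseux series solution `y(x ^ (-1 / n))`
is irreducible if `y(t)` is not a series in `t ^ m` for any divisor `m > 1` of `n`. -/
theorem isIrreducible_of_solution {n : ℕ} {A B : ℂ⟦X⟧} (hA' : d⁄dX ℂ A ≠ 0)
    (hB : (n : ℂ⟦X⟧) * B = -(X ^ (n + 1) * d⁄dX ℂ A))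
    (hA : ∀ m, 1 < m → m ∣ n → ¬ IsSeriesInPow m A) : IsIrreducible (A, B) := by
  rintro ⟨m, hm, ⟨P, Q⟩, ⟨w, hw, hAw, hBw⟩, hP, hQ⟩
  simp only at hAw hBw hP hQ
  have hX := X_dvd_of_order_eq_one hw
  obtain ⟨ζ, hζ⟩ : ∃ ζ : ℂ, IsPrimitiveRoot ζ m :=
    ⟨_, Complex.isPrimitiveRoot_exp m (by omega)⟩
  have hζ0 : ζ ≠ 0 := hζ.ne_zero (by omega)
  rw [isSeriesInPow_iff_rescale hζ] at hP hQ
  have hP' : d⁄dX ℂ P = subst w (d⁄dX ℂ A) * d⁄dX ℂ w := by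
    rw [← hAw]
    exact derivative_subst (hasSubst_of_X_dvd hX)
  have hw' : d⁄dX ℂ w ≠ 0 := fun h0 =>
    (order_eq_one_iff.1 hw).2 (by rw [← constantCoeff_derivative, h0, map_zero])
  have hP'0 : X * d⁄dX ℂ P ≠ 0 := by
    rw [hP']
    refine mul_ne_zero X_ne_zero (mul_ne_zero ?_ hw')
    rw [Ne, ← order_eq_top, order_subst hw, order_eq_top]
    exact hA'
  -- In terms of forms: `dP / Q = -n w^(-n-1) dw`. The left side is invariant under the rotation
  -- because `P` and `Q` are series in `t^m`, hence so is the right side.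
  have key : (n : ℂ⟦X⟧) * Q * (X * d⁄dX ℂ w) = -(w ^ (n + 1) * (X * d⁄dX ℂ P)) := by
    have h1 : (n : ℂ⟦X⟧) * Q = -(w ^ (n + 1) * subst w (d⁄dX ℂ A)) := by
      let φ : ℂ⟦X⟧ →ₐ[ℂ] ℂ⟦X⟧ := substAlgHom (hasSubst_of_X_dvd hX)
      have hφ : ∀ f, φ f = subst w f := fun f => by
        rw [← coe_substAlgHom (hasSubst_of_X_dvd hX)]
      have := congrArg φ hB
      rw [map_neg, map_mul, map_mul, map_pow, map_natCast, hφ, hφ, hφ, hBw,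
        subst_X_of_X_dvd hX] at this
      exact this
    rw [h1, hP']
    ring
  have key' : (n : ℂ⟦X⟧) * Q * (X * d⁄dX ℂ (rescale ζ w)) =
      -(rescale ζ w ^ (n + 1) * (X * d⁄dX ℂ P)) := by
    have := congrArg (rescale ζ) key
    rw [map_neg, map_mul, map_mul, map_mul _ (w ^ (n + 1)), map_pow, map_natCast,
      ← X_mul_derivative_rescale, ← X_mul_derivative_rescale, hP, hQ] at this
    exact this
  obtain ⟨hζn, hρ⟩ := rescale_eq_of_invariant_form hw hζ0 (n := n) (by
    refine mul_right_cancel₀ hP'0 ?_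
    linear_combination (X * d⁄dX ℂ w) * key' - (X * d⁄dX ℂ (rescale ζ w)) * key)
  refine hA m hm ((hζ.pow_eq_one_iff_dvd n).1 hζn) ?_
  rw [isSeriesInPow_iff_rescale hζ]
  obtain ⟨v, hv, hvw, hwv⟩ := exists_subst_inverse hw
  have hXv := X_dvd_of_order_eq_one hv
  have hXζ : (X : ℂ⟦X⟧) ∣ ζ • X := by
    rw [smul_eq_C_mul]
    exact dvd_mul_left _ _
  have hAv : A = subst v P := by rw [← hAw, subst_subst hX hXv, hvw, X_subst]
  have hρs : ∀ f : ℂ⟦X⟧, rescale ζ f = subst (ζ • X : ℂ⟦X⟧) f := rescale_eq_subst ζ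
  have hsc : ∀ u : ℂ⟦X⟧, X ∣ u → (subst u (ζ • X : ℂ⟦X⟧) : ℂ⟦X⟧) = C ζ * u := fun u hu => by
    rw [subst_smul (hasSubst_of_X_dvd hu), subst_X (hasSubst_of_X_dvd hu), smul_eq_C_mul]
  -- As `w` intertwines the rotation with multiplication by `ζ`, so does its inverse `v`. The
  -- rotation invariance of `P` therefore passes to `A = P(v)`.
  have hcomm : (subst (ζ • X : ℂ⟦X⟧) v : ℂ⟦X⟧) = subst v (ζ • X : ℂ⟦X⟧) := by
    have h1 : (subst (ζ • X : ℂ⟦X⟧) w : ℂ⟦X⟧) = subst w (ζ • X : ℂ⟦X⟧) := by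
      rw [← hρs, hρ, hsc w hX]
    have h2 : (subst w (subst (ζ • X : ℂ⟦X⟧) v : ℂ⟦X⟧) : ℂ⟦X⟧) = ζ • X := by
      rw [subst_subst hXζ hX, ← h1, ← subst_subst hX hXζ, hwv, subst_X_of_X_dvd hXζ]
    have h3 := congrArg (fun f : ℂ⟦X⟧ => (subst v f : ℂ⟦X⟧)) h2
    rwa [subst_subst hX hXv, hvw, X_subst] at h3
  rw [hρs, hAv, subst_subst hXv hXζ, hcomm, ← subst_subst hXζ hXv, ← hρs, hP]

/-! ### Bounding the order of a place by counting conjugates -/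

/-- The polynomial `F(Y, t ^ r)` in `Y` with power series coefficients. -/
noncomputable def specializeSnd (F : MvPolynomial (Fin 2) ℂ) (r : ℕ) : Polynomial ℂ⟦X⟧ :=
  MvPolynomial.aeval ![Polynomial.X, Polynomial.C (X ^ r)] F

theorem specializeSnd_eq_sum (F : MvPolynomial (Fin 2) ℂ) (r : ℕ) :
    specializeSnd F r = ∑ d ∈ F.support,
      Polynomial.C (C (F.coeff d) * X ^ (r * d 1)) * Polynomial.X ^ d 0 := by
  rw [specializeSnd, MvPolynomial.aeval_def, MvPolynomial.eval₂_eq']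
  refine Finset.sum_congr rfl fun d _ => ?_
  rw [Fin.prod_univ_two]
  simp only [Matrix.cons_val_zero, Matrix.cons_val_one]
  have : algebraMap ℂ (Polynomial ℂ⟦X⟧) (F.coeff d) = Polynomial.C (C (F.coeff d)) := rfl
  rw [this]
  simp only [map_mul, map_pow]
  ring

theorem natDegree_specializeSnd_le (F : MvPolynomial (Fin 2) ℂ) (r : ℕ) :
    (specializeSnd F r).natDegree ≤ F.degreeOf 0 := by
  rw [specializeSnd_eq_sum]
  refine Polynomial.natDegree_sum_le_of_forall_le _ _ fun d hd => ?_
  exact (Polynomial.natDegree_C_mul_X_pow_le _ _).trans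
    (MvPolynomial.le_degreeOf_of_mem_support 0 hd)

/-- Distinct monomials of `F` go to distinct monomials in `Y` and `t` because `r > 0`, so nothing
cancels. -/
theorem specializeSnd_ne_zero {F : MvPolynomial (Fin 2) ℂ} (hF : F ≠ 0) {r : ℕ} (hr : 0 < r) :
    specializeSnd F r ≠ 0 := by
  obtain ⟨d, hd⟩ := MvPolynomial.ne_zero_iff.1 hF
  intro h
  have h1 := congrArg (fun P => coeff (r * d 1) (P.coeff (d 0))) h
  simp only [specializeSnd_eq_sum, Polynomial.finsetSum_coeff, Polynomial.coeff_C_mul,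
    Polynomial.coeff_X_pow, map_sum, Polynomial.coeff_zero, map_zero] at h1
  rw [Finset.sum_eq_single d] at h1
  · simp [coeff_X_pow] at h1
    exact hd h1
  · intro d' _ hne
    by_cases h0 : d 0 = d' 0
    · have h2 : d 1 ≠ d' 1 := fun h2 => hne (by
        ext i
        fin_cases i
        · exact h0.symm
        · exact h2.symm)
      have h3 : ¬ (r * d 1 = r * d' 1) := fun h => h2 (Nat.eq_of_mul_eq_mul_left hr h)
      simp [h0, coeff_X_pow, h3]
    · simp [h0]
  · intro hd'
    exact absurd (MvPolynomial.notMem_support_iff.1 hd') hd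

/-- The order of the second component of an irreducible parametrization of `F = 0` is at most
the degree of `F` in its first variable. -/
theorem order_le_degreeOf {F : MvPolynomial (Fin 2) ℂ} (hF : F ≠ 0) {a b : ℂ⟦X⟧}
    (hab : MvPolynomial.aeval ![a, b] F = 0) (hirr : IsIrreducible (a, b)) {r : ℕ} (hr : 0 < r)
    (hb : b.order = r) : r ≤ F.degreeOf 0 := by
  classical
  -- The inverse of an `r`-th root of `b` reparametrizes the pair to `(α, t^r)`.
  obtain ⟨u, hu, hub⟩ := exists_pow_eq hr hb
  obtain ⟨w, hw, hwu, -⟩ := exists_subst_inverse hu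
  have hX := X_dvd_of_order_eq_one hw
  set α : ℂ⟦X⟧ := subst w a with hα
  have hbw : (subst w b : ℂ⟦X⟧) = X ^ r := by
    rw [← hub, subst_pow_of_X_dvd hX, hwu]
  have hequiv : Equivalent (a, b) (α, X ^ r) := ⟨w, hw, rfl, hbw⟩
  have hroot : MvPolynomial.aeval ![α, X ^ r] F = 0 := by
    rw [← hbw, hα, aeval_subst hX, hab, subst_zero_of_X_dvd hX]
  obtain ⟨ζ, hζ⟩ : ∃ ζ : ℂ, IsPrimitiveRoot ζ r := ⟨_, Complex.isPrimitiveRoot_exp r hr.ne'⟩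
  have hζ0 : ζ ≠ 0 := hζ.ne_zero hr.ne'
  -- If two rotates of `α` agree, then `α` is fixed by some `ξ ≠ 1` with `ξ^r = 1`; both `α` and
  -- `t^r` are then series in `t^(orderOf ξ)`, against irreducibility.
  have hinj : Set.InjOn (fun j : ℕ => rescale (ζ ^ j) α) (Finset.range r) := by
    have aux : ∀ i j, i < j → j < r → rescale (ζ ^ i) α ≠ rescale (ζ ^ j) α := by
      intro i j hij hj h
      set ξ := ζ ^ (j - i) with hξ
      have hξα : rescale ξ α = α := by
        ext l
        have h1 := congrArg (coeff l) h
        rw [coeff_rescale, coeff_rescale] at h1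
        rw [coeff_rescale]
        refine mul_left_cancel₀ (pow_ne_zero l (pow_ne_zero i hζ0)) ?_
        rw [h1, ← mul_assoc, ← mul_pow, hξ, ← pow_add, Nat.add_sub_cancel' hij.le]
      have hξr : ξ ^ r = 1 := by rw [hξ, ← pow_mul, mul_comm, pow_mul, hζ.pow_eq_one, one_pow]
      have hprim := IsPrimitiveRoot.orderOf ξ
      have hpos : 0 < orderOf ξ := orderOf_pos_iff.2 (isOfFinOrder_iff_pow_eq_one.2 ⟨r, hr, hξr⟩)
      have hne1 : orderOf ξ ≠ 1 := by
        rw [Ne, orderOf_eq_one_iff]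
        intro h1
        have := Nat.le_of_dvd (by omega) ((hζ.pow_eq_one_iff_dvd _).1 h1)
        omega
      refine hirr ⟨orderOf ξ, by omega, _, hequiv, ?_, ?_⟩
      · rw [isSeriesInPow_iff_rescale hprim]
        exact hξα
      · rw [isSeriesInPow_iff_rescale hprim]
        simp only [map_pow, rescale_X, mul_pow]
        rw [← map_pow, hξr, map_one, one_mul]
    intro i hi j hj h
    simp only [Finset.coe_range, Set.mem_Iio] at hi hj
    rcases lt_trichotomy i j with hij | hij | hij
    · exact absurd h (aux i j hij hj)
    · exact hij
    · exact absurd h.symm (aux j i hij hi)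
  -- Rotations fix `t^r`, so they carry the root `α` of `F(Y, t^r)` to further roots.
  have hsub : (Finset.range r).image (fun j : ℕ => rescale (ζ ^ j) α) ⊆
      (specializeSnd F r).roots.toFinset := by
    intro β hβ
    obtain ⟨j, -, rfl⟩ := Finset.mem_image.1 hβ
    rw [Multiset.mem_toFinset, Polynomial.mem_roots (specializeSnd_ne_zero hF hr),
      Polynomial.IsRoot.def]
    have hXζ : (X : ℂ⟦X⟧) ∣ (ζ ^ j) • X := by
      rw [smul_eq_C_mul]
      exact dvd_mul_left _ _
    have hXr : rescale (ζ ^ j) (X ^ r : ℂ⟦X⟧) = X ^ r := by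
      rw [map_pow, rescale_X, mul_pow, ← map_pow, ← pow_mul, mul_comm j, pow_mul,
        hζ.pow_eq_one, one_pow, map_one, one_mul]
    have h1 := aeval_subst hXζ α (X ^ r) F
    rw [hroot, subst_zero_of_X_dvd hXζ, ← rescale_eq_subst, ← rescale_eq_subst, hXr] at h1
    rw [← h1, specializeSnd]
    have h2 := map_aeval_pair
      ((Polynomial.aeval (R := ℂ⟦X⟧) (rescale (ζ ^ j) α)).restrictScalars ℂ)
      Polynomial.X (Polynomial.C (X ^ r)) F
    simpa using h2
  calc r = ((Finset.range r).image fun j : ℕ => rescale (ζ ^ j) α).card := by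
        rw [Finset.card_image_of_injOn hinj, Finset.card_range]
    _ ≤ (specializeSnd F r).roots.toFinset.card := Finset.card_le_card hsub
    _ ≤ (specializeSnd F r).roots.card := Multiset.toFinset_card_le _
    _ ≤ (specializeSnd F r).natDegree := Polynomial.card_roots' _
    _ ≤ F.degreeOf 0 := natDegree_specializeSnd_le F r

/-! ## Power series in `x ^ (-1 / n)` -/

theorem algebraMap_hahnSeries_apply (c : ℂ) :
    algebraMap ℂ (HahnSeries ℚ ℂ) c = HahnSeries.C c := by
  rw [HahnSeries.algebraMap_apply']
  exact HahnSeries.ofPowerSeries_C c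

/-- The substitution `f(t) ↦ f(x ^ (-1 / n))`. -/
noncomputable def puiseuxHom {n : ℕ} (hn : 0 < n) : ℂ⟦X⟧ →ₐ[ℂ] HahnSeries ℚ ℂ :=
  { (HahnSeries.embDomainRingHom
      ({ toFun := fun i : ℕ => (i : ℚ) / n
         map_zero' := by simp
         map_add' := fun i j => by push_cast; ring } : ℕ →+ ℚ)
      (fun i j h => by
        have hn' : (n : ℚ) ≠ 0 := by exact_mod_cast hn.ne'
        have h' : (i : ℚ) / n = (j : ℚ) / n := h
        rw [div_left_inj' hn'] at h'
        exact_mod_cast h')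
      (fun i j => by
        have hn' : (0 : ℚ) < n := by exact_mod_cast hn
        change (i : ℚ) / n ≤ (j : ℚ) / n ↔ i ≤ j
        rw [div_le_div_iff_of_pos_right hn']
        exact Nat.cast_le)).comp
      (RingEquiv.toRingHom (HahnSeries.toPowerSeries (R := ℂ)).symm) with
    commutes' := fun c => by
      rw [algebraMap_hahnSeries_apply]
      have h : (HahnSeries.toPowerSeries (R := ℂ)).symm (C c) = HahnSeries.C c := by
        rw [RingEquiv.symm_apply_eq]
        ext i
        rw [HahnSeries.coeff_toPowerSeries, coeff_C, HahnSeries.C_apply, HahnSeries.coeff_single]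
        congr
      change HahnSeries.embDomainRingHom _ _ _ (HahnSeries.toPowerSeries.symm (C c)) = _
      rw [h]
      exact HahnSeries.embDomainRingHom_C }

section

variable {n : ℕ} (hn : 0 < n)

theorem puiseuxHom_coeff_div (f : ℂ⟦X⟧) (i : ℕ) :
    (puiseuxHom hn f).coeff ((i : ℚ) / n) = coeff i f :=
  (HahnSeries.embDomain_coeff (a := i)).trans HahnSeries.coeff_toPowerSeries_symm

theorem puiseuxHom_coeff_of_forall_ne (f : ℂ⟦X⟧) {g : ℚ} (hg : ∀ i : ℕ, g ≠ (i : ℚ) / n) :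
    (puiseuxHom hn f).coeff g = 0 :=
  HahnSeries.embDomain_of_notMem_range (by
    rintro ⟨i, hi⟩
    exact hg i hi.symm)

theorem puiseuxHom_coeff_zero (f : ℂ⟦X⟧) : (puiseuxHom hn f).coeff 0 = constantCoeff f := by
  have := puiseuxHom_coeff_div hn f 0
  simpa using this

theorem puiseuxHom_injective : Function.Injective (puiseuxHom hn) := by
  intro f g h
  ext i
  rw [← puiseuxHom_coeff_div hn f, h, puiseuxHom_coeff_div]

theorem puiseuxHom_C (c : ℂ) : puiseuxHom hn (C c) = HahnSeries.C c :=
  ((puiseuxHom hn).commutes c).trans (algebraMap_hahnSeries_apply c)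

theorem puiseuxHom_X : puiseuxHom hn X = HahnSeries.single (1 / (n : ℚ)) 1 := by
  ext g
  by_cases h : ∃ i : ℕ, g = (i : ℚ) / n
  · obtain ⟨i, rfl⟩ := h
    have hn' : (n : ℚ) ≠ 0 := by exact_mod_cast hn.ne'
    rw [puiseuxHom_coeff_div, coeff_X, HahnSeries.coeff_single]
    have : (i : ℚ) / n = 1 / n ↔ i = 1 := by rw [div_left_inj' hn', Nat.cast_eq_one]
    simp only [this]
  · push Not at h
    rw [puiseuxHom_coeff_of_forall_ne hn _ h, HahnSeries.coeff_single_of_ne]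
    intro h1
    exact h 1 (by rw [h1]; simp)

theorem puiseuxHom_polynomial (p : Polynomial ℂ) :
    puiseuxHom hn (p : ℂ⟦X⟧) =
      Polynomial.aeval (HahnSeries.single (1 / (n : ℚ)) (1 : ℂ)) p := by
  induction p using Polynomial.induction_on' with
  | add p q hp hq => rw [Polynomial.coe_add, map_add, map_add, hp, hq]
  | monomial i c =>
    rw [← Polynomial.C_mul_X_pow_eq_monomial, Polynomial.coe_mul, Polynomial.coe_pow,
      Polynomial.coe_C, Polynomial.coe_X, map_mul, map_pow, puiseuxHom_X, puiseuxHom_C, map_mul,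
      map_pow, Polynomial.aeval_X, Polynomial.aeval_C, algebraMap_hahnSeries_apply]

theorem coeff_X_mul_derivative (f : ℂ⟦X⟧) (i : ℕ) : coeff i (X * d⁄dX ℂ f) = i * coeff i f := by
  cases i with
  | zero => simp
  | succ i =>
    rw [coeff_succ_X_mul, coeff_derivative]
    push_cast
    ring

/-- Chain rule for `t = x^(-1/n)`, where `dt/dx = -(1/n) t^(n+1)`. -/
theorem derivX_puiseuxHom (f : ℂ⟦X⟧) :
    derivX (puiseuxHom hn f) =
      puiseuxHom hn (C (-(1 / (n : ℂ))) * (X ^ (n + 1) * d⁄dX ℂ f)) := by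
  have hn' : (n : ℚ) ≠ 0 := by exact_mod_cast hn.ne'
  have hnC : (n : ℂ) ≠ 0 := by exact_mod_cast hn.ne'
  ext g
  change -((g - 1 : ℚ) : ℂ) * (puiseuxHom hn f).coeff (g - 1) = _
  by_cases h : ∃ i : ℕ, g = (i : ℚ) / n
  · obtain ⟨i, rfl⟩ := h
    rw [puiseuxHom_coeff_div, coeff_C_mul, pow_succ, mul_assoc]
    rcases le_or_gt n i with hi | hi
    · obtain ⟨j, rfl⟩ := Nat.exists_eq_add_of_le' hi
      rw [coeff_X_pow_mul, coeff_X_mul_derivative]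
      have e : ((j + n : ℕ) : ℚ) / n - 1 = (j : ℚ) / n := by
        push_cast
        field_simp
        ring
      rw [e, puiseuxHom_coeff_div]
      push_cast
      ring
    · have e1 : coeff i (X ^ n * (X * d⁄dX ℂ f)) = 0 :=
        X_pow_dvd_iff.1 (dvd_mul_right _ _) i hi
      rw [e1, puiseuxHom_coeff_of_forall_ne, mul_zero, mul_zero]
      intro j hj
      have : (i : ℚ) / n < 1 := by
        rw [div_lt_one (by exact_mod_cast hn)]
        exact_mod_cast hi
      have h2 : (0 : ℚ) ≤ (j : ℚ) / n := by positivity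
      linarith
  · push Not at h
    rw [puiseuxHom_coeff_of_forall_ne hn _ h, puiseuxHom_coeff_of_forall_ne, mul_zero]
    intro j hj
    apply h (j + n)
    push_cast
    rw [add_div, div_self hn', ← hj]
    ring

theorem hasDenominator_puiseuxHom (f : ℂ⟦X⟧) : HasDenominator n (puiseuxHom hn f) := by
  intro g hg
  by_contra h
  push Not at h
  refine hg (puiseuxHom_coeff_of_forall_ne hn f fun i hi => h i ?_)
  rw [hi]
  simp

theorem hasValueAtInfinity_puiseuxHom {f : ℂ⟦X⟧} {c : ℂ} (hf : constantCoeff f = c) :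
    HasValueAtInfinity (puiseuxHom hn f) c := by
  refine ⟨fun g hg => puiseuxHom_coeff_of_forall_ne hn f fun i hi => ?_, ?_⟩
  · have : (0 : ℚ) ≤ (i : ℚ) / n := by positivity
    linarith
  · rw [puiseuxHom_coeff_zero, hf]

theorem exists_eq_puiseuxHom {y : HahnSeries ℚ ℂ} (hy : HasDenominator n y) {c : ℂ}
    (hc : HasValueAtInfinity y c) : ∃ f : ℂ⟦X⟧, constantCoeff f = c ∧ y = puiseuxHom hn f := by
  have e : y = puiseuxHom hn (mk fun i => y.coeff ((i : ℚ) / n)) := by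
    ext g
    by_cases h : ∃ i : ℕ, g = (i : ℚ) / n
    · obtain ⟨i, rfl⟩ := h
      rw [puiseuxHom_coeff_div, coeff_mk]
    · push Not at h
      rw [puiseuxHom_coeff_of_forall_ne hn _ h]
      by_contra hg
      obtain ⟨j, hj⟩ := hy g hg
      have hg0 : 0 ≤ g := not_lt.1 fun h0 => hg (hc.1 g h0)
      have hn' : (0 : ℚ) < n := by exact_mod_cast hn
      have hj0 : 0 ≤ j := by
        have : (0 : ℚ) ≤ j := by
          rw [hj, le_div_iff₀ hn', zero_mul] at hg0
          exact hg0
        exact_mod_cast this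
      lift j to ℕ using hj0
      exact h j (by simpa using hj)
  refine ⟨_, ?_, e⟩
  have := puiseuxHom_coeff_zero hn (mk fun i => y.coeff ((i : ℚ) / n))
  rw [← this, ← e, hc.2]

/-! ### The ramification order -/

theorem hasDenominator_of_isSeriesInPow {m d : ℕ} (hm : 0 < m) (hnd : n = m * d) {f : ℂ⟦X⟧}
    (hf : IsSeriesInPow m f) : HasDenominator d (puiseuxHom hn f) := by
  intro g hg
  by_cases h : ∃ i : ℕ, g = (i : ℚ) / n
  · obtain ⟨i, rfl⟩ := h
    have hi : m ∣ i := by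
      by_contra hi
      exact hg (by rw [puiseuxHom_coeff_div, hf i hi])
    obtain ⟨l, rfl⟩ := hi
    refine ⟨l, ?_⟩
    have hm' : (m : ℚ) ≠ 0 := by exact_mod_cast hm.ne'
    rw [hnd]
    push_cast
    rw [mul_div_mul_left _ _ hm']
  · push Not at h
    exact absurd (puiseuxHom_coeff_of_forall_ne hn _ h) hg

theorem ramificationOrder_spec {y : HahnSeries ℚ ℂ} (hy : IsPuiseux y) :
    0 < ramificationOrder y ∧ HasDenominator (ramificationOrder y) y :=
  Nat.sInf_mem (s := {n : ℕ | 0 < n ∧ HasDenominator n y}) hy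

theorem ramificationOrder_le {n : ℕ} (hn : 0 < n) {y : HahnSeries ℚ ℂ} (hy : HasDenominator n y) :
    ramificationOrder y ≤ n :=
  Nat.sInf_le ⟨hn, hy⟩

theorem not_isSeriesInPow_of_ramificationOrder {f : ℂ⟦X⟧}
    (hr : ramificationOrder (puiseuxHom hn f) = n) {m : ℕ} (hm : 1 < m) (hmn : m ∣ n) :
    ¬ IsSeriesInPow m f := by
  intro hf
  obtain ⟨d, hd⟩ := hmn
  have hd0 : 0 < d := by
    rcases Nat.eq_zero_or_pos d with rfl | h
    · omega
    · exact h
  have h1 := ramificationOrder_le hd0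
    (hasDenominator_of_isSeriesInPow hn (by omega) hd hf)
  rw [hr] at h1
  nlinarith

/-- Let `n'` be the ramification order and `m = n / gcd(n, n')`. An exponent of the form `i/n =
j/n'` forces `m ∣ i`, so `f` is a series in `t^m`; hence `m = 1` and `n ∣ n'`. -/
theorem ramificationOrder_puiseuxHom {f : ℂ⟦X⟧}
    (hf : ∀ m, 1 < m → m ∣ n → ¬ IsSeriesInPow m f) :
    ramificationOrder (puiseuxHom hn f) = n := by
  have hden := hasDenominator_puiseuxHom hn f
  have hle := ramificationOrder_le hn hden
  obtain ⟨hpos, hden'⟩ := ramificationOrder_spec ⟨n, hn, hden⟩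
  set n' := ramificationOrder (puiseuxHom hn f)
  obtain ⟨m, hm⟩ := Nat.gcd_dvd_left n n'
  obtain ⟨m', hm'⟩ := Nat.gcd_dvd_right n n'
  have hg : 0 < Nat.gcd n n' := Nat.gcd_pos_of_pos_left _ hn
  have hcop : Nat.Coprime m m' := by
    have := Nat.coprime_div_gcd_div_gcd hg
    rwa [Nat.div_eq_of_eq_mul_right hg hm, Nat.div_eq_of_eq_mul_right hg hm'] at this
  have hser : IsSeriesInPow m f := by
    intro i hi
    by_contra hne
    obtain ⟨j, hj⟩ := hden' ((i : ℚ) / n) (by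
      rw [HahnSeries.mem_support, puiseuxHom_coeff_div]
      exact hne)
    have hn0 : (n : ℚ) ≠ 0 := by exact_mod_cast hn.ne'
    have hn0' : (n' : ℚ) ≠ 0 := by exact_mod_cast hpos.ne'
    rw [div_eq_div_iff hn0 hn0'] at hj
    have hj' : (i : ℤ) * n' = j * n := by exact_mod_cast hj
    have hj2 : (i : ℤ) * m' = j * m := by
      have hg' : (Nat.gcd n n' : ℤ) ≠ 0 := by exact_mod_cast hg.ne'
      refine mul_left_cancel₀ hg' ?_
      have e1 : (n : ℤ) = (Nat.gcd n n' : ℤ) * m := by exact_mod_cast hm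
      have e2 : (n' : ℤ) = (Nat.gcd n n' : ℤ) * m' := by exact_mod_cast hm'
      generalize (Nat.gcd n n' : ℤ) = d at e1 e2
      rw [e1, e2] at hj'
      linear_combination hj'
    have : (m : ℤ) ∣ (i : ℤ) * m' := ⟨j, by rw [hj2]; ring⟩
    have h2 : m ∣ i * m' := by exact_mod_cast this
    exact hi (hcop.dvd_of_dvd_mul_right h2)
  have hm1 : m = 1 := by
    have hm0 : m ≠ 0 := by
      rintro rfl
      omega
    by_contra h1
    exact hf m (by omega) ⟨_, by rw [mul_comm]; exact hm⟩ hser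
  have : n ∣ n' := by
    rw [hm1, mul_one] at hm
    exact hm ▸ Nat.gcd_dvd_right n n'
  exact le_antisymm hle (Nat.le_of_dvd hpos this)

/-! ### Truncations -/

theorem order_puiseuxHom {f : ℂ⟦X⟧} {k : ℕ} (hf : f.order = k) :
    (puiseuxHom hn f).order = (k : ℚ) / n := by
  obtain ⟨hk, hlt⟩ := order_eq_nat.1 hf
  have hne : (puiseuxHom hn f).coeff ((k : ℚ) / n) ≠ 0 := by rwa [puiseuxHom_coeff_div]
  refine le_antisymm (HahnSeries.order_le_of_coeff_ne_zero hne) ?_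
  have h0 : puiseuxHom hn f ≠ 0 := by
    intro h
    rw [h] at hne
    exact hne rfl
  have h1 : (puiseuxHom hn f).coeff (puiseuxHom hn f).order ≠ 0 :=
    HahnSeries.coeff_order_eq_zero.not.2 h0
  by_cases h : ∃ i : ℕ, (puiseuxHom hn f).order = (i : ℚ) / n
  · obtain ⟨i, hi⟩ := h
    rw [hi, puiseuxHom_coeff_div] at h1
    have hki : k ≤ i := not_lt.1 fun hi' => h1 (hlt i hi')
    rw [hi]
    gcongr
  · push Not at h
    exact absurd (puiseuxHom_coeff_of_forall_ne hn _ h) h1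

theorem firstTermsAtInfinity_puiseuxHom (N : ℕ) {f : ℂ⟦X⟧}
    (hr : ramificationOrder (puiseuxHom hn f) = n) :
    firstTermsAtInfinity N (puiseuxHom hn f) = puiseuxHom hn (firstTerms N f : ℂ⟦X⟧) := by
  rw [firstTermsAtInfinity, hr, puiseuxHom_coeff_zero, firstTerms, Polynomial.coe_add,
    Polynomial.coe_C, map_add, puiseuxHom_C, ← puiseuxHom_C hn, ← map_sub]
  congr 1
  set g := f - C (constantCoeff f)
  by_cases hg : g = 0
  · simp [hg]
  rw [order_puiseuxHom hn (k := g.order.toNat) (coe_toNat_order hg).symm]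
  have hn' : (0 : ℚ) < n := by exact_mod_cast hn
  ext q
  rw [HahnSeries.coeff_truncLT]
  by_cases h : ∃ i : ℕ, q = (i : ℚ) / n
  · obtain ⟨i, rfl⟩ := h
    rw [puiseuxHom_coeff_div, puiseuxHom_coeff_div, Polynomial.coeff_coe, coeff_trunc]
    refine if_congr ?_ rfl rfl
    rw [← add_div, div_lt_div_iff_of_pos_right hn']
    exact_mod_cast Iff.rfl
  · push Not at h
    rw [puiseuxHom_coeff_of_forall_ne hn _ h, puiseuxHom_coeff_of_forall_ne hn _ h, ite_self]

theorem firstTermsAtInfinity_C (N : ℕ) (c : ℂ) :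
    firstTermsAtInfinity N (HahnSeries.C c) = HahnSeries.C c := by
  simp [firstTermsAtInfinity]

theorem firstTerms_congr {N k : ℕ} (hN : 0 < N) (hk : 0 < k) {g g' : ℂ⟦X⟧} (hg : g.order = k)
    (h : X ^ (k + N) ∣ g' - g) (c : ℂ) : firstTerms N (C c + g') = firstTerms N (C c + g) := by
  have hc : ∀ m < k + N, coeff m g' = coeff m g := fun m hm => coeff_eq_of_X_pow_dvd_sub h hm
  obtain ⟨hg1, hg2⟩ := order_eq_nat.1 hg
  have hg' : g'.order = k := by
    rw [order_eq_nat]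
    exact ⟨by rwa [hc k (by omega)], fun i hi => by rw [hc i (by omega), hg2 i hi]⟩
  have h0 : constantCoeff g = 0 := by
    rw [← coeff_zero_eq_constantCoeff_apply, hg2 0 hk]
  have h0' : constantCoeff g' = 0 := by
    rw [← coeff_zero_eq_constantCoeff_apply, hc 0 (by omega), hg2 0 hk]
  simp only [firstTerms, map_add, constantCoeff_C, h0, h0', add_zero, add_sub_cancel_left, hg, hg']
  congr 1
  ext m
  rw [coeff_trunc, coeff_trunc]
  split_ifs with hm
  · exact hc m (by simpa using hm)
  · rfl

end

/-! ## The associated differential equation -/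

/-- The residual `t ^ (n + 1) (s ^ k)' + n b(s)` of the associated differential equation of the
parametrization `(y₀ + t ^ k, b)`. -/
noncomputable def assocSeries (n k : ℕ) (b s : ℂ⟦X⟧) : ℂ⟦X⟧ :=
  X ^ (n + 1) * d⁄dX ℂ (s ^ k) + (n : ℂ⟦X⟧) * (subst s b : ℂ⟦X⟧)

/-- Both terms react at the same order: `s^k` changes from `t^(k+i)` on, which `t^(n+1) d/dt` moves
to `t^(n+k+i)`, and `b(s)` changes from `t^(n+k+i)` on. -/
theorem assocSeries_congr {n k : ℕ} (hk : 0 < k) {b s s' : ℂ⟦X⟧} (hs : X ∣ s)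
    (hb : X ^ (n + k) ∣ b) {i : ℕ} (h : X ^ (i + 1) ∣ s' - s) :
    X ^ (n + k + i) ∣ assocSeries n k b s' - assocSeries n k b s := by
  obtain ⟨k, rfl⟩ := Nat.exists_eq_add_of_le' hk
  have e : assocSeries n (k + 1) b s' - assocSeries n (k + 1) b s =
      X ^ (n + 1) * d⁄dX ℂ (s' ^ (k + 1) - s ^ (k + 1)) +
        (n : ℂ⟦X⟧) * ((subst s' b : ℂ⟦X⟧) - (subst s b : ℂ⟦X⟧)) := by
    rw [assocSeries, assocSeries, map_sub]
    ring
  rw [e]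
  refine dvd_add ?_ ((X_pow_dvd_subst_congr hs h hb).mul_left _)
  rw [show n + (k + 1) + i = n + 1 + (k + i) by ring, pow_add]
  refine mul_dvd_mul_left _ (X_pow_dvd_derivative ?_)
  rw [show k + i + 1 = k + 1 + i by ring]
  exact X_pow_dvd_pow_sub_pow hs h (k + 1)

theorem assocSeries_perturb {n k : ℕ} (hk : 0 < k) {b s : ℂ⟦X⟧} (hs : X ∣ s)
    (hb : X ^ (n + k) ∣ b) {i : ℕ} (hi : 1 ≤ i) (σ : ℂ) :
    X ^ (n + k + i + 1) ∣ assocSeries n k b (s + C σ * X ^ (i + 1)) - assocSeries n k b s -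
      C ((k * (k + i) * coeff 1 s ^ (k - 1) +
        n * coeff (n + k) b * (n + k) * coeff 1 s ^ (n + k - 1)) * σ) * X ^ (n + k + i) := by
  set s' := s + C σ * X ^ (i + 1) with hs'
  set c := (k : ℂ) * coeff 1 s ^ (k - 1) * σ with hc
  set c' := coeff (n + k) b * (((n + k : ℕ) : ℂ) * coeff 1 s ^ (n + k - 1) * σ) with hc'
  have h1 : X ^ (k + i + 1) ∣ s' ^ k - s ^ k - C c * X ^ (k + i) :=
    X_pow_dvd_pow_perturb hs hi k σ
  have h2 : X ^ (n + k + i + 1) ∣ (subst s' b : ℂ⟦X⟧) - subst s b - C c' * X ^ (n + k + i) :=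
    X_pow_dvd_subst_perturb hs hi hb σ
  have h3 := mul_dvd_mul_left (X ^ (n + 1)) (X_pow_dvd_derivative h1)
  rw [← pow_add, show n + 1 + (k + i) = n + k + i + 1 by ring] at h3
  have h4 := dvd_add h3 (h2.mul_left (n : ℂ⟦X⟧))
  convert h4 using 1
  have h5 : d⁄dX ℂ (C c * X ^ (k + i)) = C c * ((k + i : ℕ) : ℂ⟦X⟧) * X ^ (k + i - 1) := by
    rw [Derivation.leibniz, derivative_C, derivative_pow, derivative_X]
    simp
    ring
  have h6 : (X : ℂ⟦X⟧) ^ (n + k + i) = X ^ (n + 1) * X ^ (k + i - 1) := by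
    rw [← pow_add]
    congr 1
    omega
  have h7 : C ((k * (k + i) * coeff 1 s ^ (k - 1) +
      n * coeff (n + k) b * (n + k) * coeff 1 s ^ (n + k - 1)) * σ) =
      C c * ((k + i : ℕ) : ℂ⟦X⟧) + (n : ℂ⟦X⟧) * C c' := by
    rw [hc, hc']
    simp only [map_add, map_mul, map_natCast, Nat.cast_add]
    ring
  rw [map_sub, map_sub, h5, h7, h6, assocSeries, assocSeries]
  ring

theorem coeff_pow_of_X_dvd {s : ℂ⟦X⟧} (hs : X ∣ s) (k : ℕ) :
    coeff k (s ^ k) = coeff 1 s ^ k := by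
  obtain ⟨p, rfl, hp⟩ := exists_eq_X_mul hs
  have := coeff_X_pow_mul (p ^ k) k 0
  rw [zero_add] at this
  rw [← hp, mul_pow, this]
  simp

theorem coeff_subst_of_X_pow_dvd {s b : ℂ⟦X⟧} (hs : X ∣ s) {r : ℕ} (hb : X ^ r ∣ b) :
    coeff r (subst s b : ℂ⟦X⟧) = coeff r b * coeff 1 s ^ r := by
  obtain ⟨g, rfl⟩ := hb
  rw [subst_mul_of_X_dvd hs, subst_pow_of_X_dvd hs, subst_X_of_X_dvd hs]
  obtain ⟨p, rfl, hp⟩ := exists_eq_X_mul hs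
  have h1 := coeff_X_pow_mul g r 0
  have h2 := coeff_X_pow_mul (p ^ r * (subst (X * p) g : ℂ⟦X⟧)) r 0
  rw [zero_add] at h1 h2
  rw [mul_pow, mul_assoc, h1, h2, coeff_zero_eq_constantCoeff_apply,
    coeff_zero_eq_constantCoeff_apply, map_mul, map_pow, hp, constantCoeff_subst_of_X_dvd hs]
  ring

theorem coeff_X_pow_mul_derivative (f : ℂ⟦X⟧) (n i : ℕ) :
    coeff (n + i) (X ^ (n + 1) * d⁄dX ℂ f) = i * coeff i f := by
  rw [pow_succ, mul_assoc, add_comm, coeff_X_pow_mul, coeff_X_mul_derivative]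

/-- The equation for `σ₁`, later used to eliminate the leading coefficient of `b` from the
linearisation. -/
theorem leading_relation {n k : ℕ} {b s : ℂ⟦X⟧} (hs : X ∣ s)
    (hb : X ^ (n + k) ∣ b) (h : X ^ (n + k + 1) ∣ assocSeries n k b s) :
    k * coeff 1 s ^ k + n * (coeff (n + k) b * coeff 1 s ^ (n + k)) = 0 := by
  have h1 := X_pow_dvd_iff.1 h (n + k) (by omega)
  rwa [assocSeries, map_add, coeff_X_pow_mul_derivative, coeff_pow_of_X_dvd hs, ← map_natCast C,
    coeff_C_mul, coeff_subst_of_X_pow_dvd hs hb] at h1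

/-- Beyond the resonance at the exponent `n + 1`, approximate solutions of the associated
differential equation extend to solutions. -/
theorem exists_assocSeries_eq_zero {n k N : ℕ} (hk : 0 < k) (hN : n < N)
    {b s₀ : ℂ⟦X⟧} (hs₀ : X ∣ s₀) (hb : X ^ (n + k) ∣ b) (h1 : coeff 1 s₀ ≠ 0)
    (h : X ^ (n + k + N) ∣ assocSeries n k b s₀) :
    ∃ s, assocSeries n k b s = 0 ∧ X ^ (N + 1) ∣ s - s₀ := by
  refine exists_zero_of_step (assocSeries n k b) (n + k) N s₀ h ?_ ?_
  · intro i _ s s' hs hs'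
    exact assocSeries_congr hk (X_dvd_of_X_pow_dvd_sub hs hs₀) hb hs'
  · intro i hi s hs he
    have hX := X_dvd_of_X_pow_dvd_sub hs hs₀
    have hc : coeff 1 s ≠ 0 := by rwa [coeff_eq_of_X_pow_dvd_sub hs (by omega)]
    have hrel := leading_relation hX hb ((pow_dvd_pow X (by omega)).trans he)
    set L := (k * (k + i) * coeff 1 s ^ (k - 1) +
        n * coeff (n + k) b * (n + k) * coeff 1 s ^ (n + k - 1) : ℂ) with hL
    have hL0 : L ≠ 0 := by
      have e1 : coeff 1 s * coeff 1 s ^ (k - 1) = coeff 1 s ^ k := by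
        rw [← pow_succ']
        congr 1
        omega
      have e2 : coeff 1 s * coeff 1 s ^ (n + k - 1) = coeff 1 s ^ (n + k) := by
        rw [← pow_succ']
        congr 1
        omega
      -- The leading relation turns the second summand of `σ₁ L` into `-(n + k) k σ₁^k`. What
      -- remains vanishes only at `i = n`, and here `i ≥ N > n`.
      have e3 : coeff 1 s * L = k * coeff 1 s ^ k * ((i : ℂ) - n) := by
        rw [hL]
        linear_combination (k : ℂ) * (k + i) * e1 +
          (n : ℂ) * coeff (n + k) b * (n + k) * e2 + (n + k : ℂ) * hrel
      intro h0
      rw [h0, mul_zero] at e3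
      have hin : (i : ℂ) - n ≠ 0 := sub_ne_zero.2 (by exact_mod_cast (by omega : i ≠ n))
      exact mul_ne_zero (mul_ne_zero (by exact_mod_cast hk.ne') (pow_ne_zero _ hc)) hin e3.symm
    obtain ⟨e, he⟩ := he
    obtain ⟨u, hu⟩ := assocSeries_perturb hk hX hb (by omega : 1 ≤ i) (-constantCoeff e / L)
    rw [← hL, mul_div_cancel₀ _ hL0, sub_eq_iff_eq_add, sub_eq_iff_eq_add, he] at hu
    obtain ⟨v, hv⟩ := X_dvd_sub_C (f := e)
    refine ⟨-constantCoeff e / L, u + v, ?_⟩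
    rw [hu]
    rw [sub_eq_iff_eq_add] at hv
    generalize constantCoeff e = e0 at hv
    rw [hv, map_neg]
    ring

theorem X_pow_dvd_assocSeries_sub {n k j : ℕ} {b b' s : ℂ⟦X⟧} (hs : X ∣ s)
    (h : X ^ j ∣ b' - b) : X ^ j ∣ assocSeries n k b' s - assocSeries n k b s := by
  have e : assocSeries n k b' s - assocSeries n k b s = (n : ℂ⟦X⟧) * subst s (b' - b) := by
    rw [assocSeries, assocSeries, subst_sub (hasSubst_of_X_dvd hs), mul_sub]
    ring
  rw [e]
  exact (X_pow_dvd_subst hs h).mul_left _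

theorem X_pow_dvd_of_sub {j : ℕ} {f g : ℂ⟦X⟧} (h : X ^ j ∣ f - g) (hg : X ^ j ∣ g) : X ^ j ∣ f := by
  simpa using dvd_add h hg

/-! ## The Newton polygon method -/

theorem polynomial_X_pow_dvd_iff {p : Polynomial ℂ} {j : ℕ} :
    Polynomial.X ^ j ∣ p ↔ (X : ℂ⟦X⟧) ^ j ∣ (p : ℂ⟦X⟧) := by
  rw [Polynomial.X_pow_dvd_iff, X_pow_dvd_iff]
  simp

theorem coe_comp {b s : Polynomial ℂ} (hs : X ∣ (s : ℂ⟦X⟧)) :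
    ((b.comp s : Polynomial ℂ) : ℂ⟦X⟧) = (subst (s : ℂ⟦X⟧) (b : ℂ⟦X⟧) : ℂ⟦X⟧) := by
  rw [subst_coe (hasSubst_of_X_dvd hs)]
  induction b using Polynomial.induction_on' with
  | add p q hp hq => rw [Polynomial.add_comp, Polynomial.coe_add, hp, hq, map_add]
  | monomial i c =>
    rw [Polynomial.monomial_comp, Polynomial.aeval_monomial, Polynomial.coe_mul,
      Polynomial.coe_pow, Polynomial.coe_C]
    rfl

theorem comp_C_add_X_pow (y₀ : ℂ) (k : ℕ) (s : Polynomial ℂ) :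
    (Polynomial.C y₀ + Polynomial.X ^ k).comp s = Polynomial.C y₀ + s ^ k := by
  simp

theorem coe_assocResidual (n k : ℕ) (y₀ : ℂ) {b s : Polynomial ℂ} (hs : X ∣ (s : ℂ⟦X⟧)) :
    (assocResidual n (Polynomial.C y₀ + Polynomial.X ^ k) b s : ℂ⟦X⟧) =
      assocSeries n k (b : ℂ⟦X⟧) (s : ℂ⟦X⟧) := by
  rw [assocResidual, mul_comm (Polynomial.comp _ _), ← Polynomial.derivative_comp,
    comp_C_add_X_pow, map_add, Polynomial.derivative_C, zero_add, Polynomial.coe_add,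
    Polynomial.coe_mul, Polynomial.coe_mul, coe_comp hs, ← derivative_coe, assocSeries,
    Polynomial.coe_pow, Polynomial.coe_pow, Polynomial.coe_X]
  congr 2
  rw [← Polynomial.coeToPowerSeries.ringHom_apply, map_natCast]

theorem newtonApprox_spec {n r : ℕ} {a b : Polynomial ℂ} {i : ℕ} {s : Polynomial ℂ}
    (hs : s ∈ newtonApprox n r a b i) :
    Polynomial.X ∣ s ∧
      (0 < i → s.coeff 1 ≠ 0 ∧ Polynomial.X ^ (r + i) ∣ assocResidual n a b s) := by
  induction i generalizing s with
  | zero =>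
    have : s = 0 := hs
    simp [this]
  | succ i ih =>
    obtain ⟨s₁, hs₁, σ, hσ, rfl, hdvd⟩ := hs
    obtain ⟨h1, h2⟩ := ih hs₁
    refine ⟨?_, fun _ => ⟨?_, by rwa [← add_assoc]⟩⟩
    · rw [Polynomial.X_dvd_iff] at h1 ⊢
      simp [h1]
    rcases Nat.eq_zero_or_pos i with rfl | hi
    · have : s₁ = 0 := hs₁
      simpa [this] using hσ rfl
    · have := (h2 hi).1
      rw [Polynomial.coeff_add, Polynomial.coeff_C_mul_X_pow, if_neg (by omega), add_zero]
      exact this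

theorem X_pow_dvd_sub_trunc (j : ℕ) (f : ℂ⟦X⟧) : X ^ j ∣ (trunc j f : ℂ⟦X⟧) - f := by
  rw [X_pow_dvd_iff]
  intro m hm
  rw [map_sub, Polynomial.coeff_coe, coeff_trunc, if_pos hm, sub_self]

/-- Cutting `s` after `t^i` alters the residual only from `t^(n+k+i)` on, so each truncation meets
its divisibility condition, including at a resonant step, where the coefficient of `s` is one
admissible choice. -/
theorem trunc_mem_newtonApprox {n k N : ℕ} (hk : 0 < k) (y₀ : ℂ) {b : Polynomial ℂ}
    (hb : X ^ (n + k) ∣ (b : ℂ⟦X⟧)) {s : ℂ⟦X⟧} (hs : s.order = 1)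
    (h : X ^ (n + k + N) ∣ assocSeries n k b s) {i : ℕ} (hi : i ≤ N) :
    trunc (i + 1) s ∈
      newtonApprox n (n + k) (Polynomial.C y₀ + Polynomial.X ^ k) b i := by
  obtain ⟨hX, h1⟩ := order_eq_one_iff.1 hs
  induction i with
  | zero =>
    change trunc (0 + 1) s = 0
    rw [zero_add, trunc_one_left, coeff_zero_eq_constantCoeff_apply, X_dvd_iff.1 hX, map_zero]
  | succ i ih =>
    have hd := X_pow_dvd_sub_trunc (i + 1 + 1) s
    refine ⟨_, ih (by omega), coeff (i + 1) s, ?_, ?_, ?_⟩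
    · rintro rfl
      exact h1
    · rw [trunc_succ, Polynomial.C_mul_X_pow_eq_monomial]
    · rw [polynomial_X_pow_dvd_iff, coe_assocResidual n k y₀ (X_dvd_of_X_pow_dvd_sub hd hX),
        add_assoc (n + k) i 1]
      exact X_pow_dvd_of_sub (assocSeries_congr hk hX hb hd)
        ((pow_dvd_pow X (by omega)).trans h)

theorem firstTerms_C_add_X_pow {N k : ℕ} (hN : 0 < N) (hk : 0 < k) (y₀ : ℂ) :
    firstTerms N (C y₀ + X ^ k) = Polynomial.C y₀ + Polynomial.X ^ k := by
  have h0 : constantCoeff (C y₀ + X ^ k : ℂ⟦X⟧) = y₀ := by simp [hk.ne']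
  rw [firstTerms, h0, add_sub_cancel_left, order_X_pow]
  congr 1
  have := trunc_coe_eq_self (n := k + N) (f := (Polynomial.X ^ k : Polynomial ℂ)) (by
    rw [Polynomial.natDegree_X_pow]
    omega)
  simpa using this

theorem firstTerms_of_constantCoeff_eq_zero (N : ℕ) {b : ℂ⟦X⟧} (hb : constantCoeff b = 0) :
    firstTerms N b = trunc (b.order.toNat + N) b := by
  rw [firstTerms, hb]
  simp

theorem natTrailingDegree_trunc {b : ℂ⟦X⟧} {r j : ℕ} (hb : b.order = r) (hj : r < j) :
    (trunc j b).natTrailingDegree = r := by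
  obtain ⟨h1, h2⟩ := order_eq_nat.1 hb
  have h3 : (trunc j b).coeff r ≠ 0 := by rwa [coeff_trunc, if_pos hj]
  refine le_antisymm (Polynomial.natTrailingDegree_le_of_ne_zero h3) ?_
  refine Polynomial.le_natTrailingDegree (fun h => h3 (by rw [h, Polynomial.coeff_zero])) ?_
  intro i hi
  rw [coeff_trunc, h2 i hi, ite_self]

theorem X_pow_dvd_of_order {b : ℂ⟦X⟧} {r : ℕ} (hb : b.order = r) : X ^ r ∣ b :=
  X_pow_dvd_iff.2 (order_eq_nat.1 hb).2

/-! ## Solutions and the output of the algorithm -/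

/-- The coefficients of `B` when `(A, B)` comes from a solution `A(x ^ (-1 / n))`. -/
theorem coeff_add_of_solution {n : ℕ} {A B : ℂ⟦X⟧}
    (h : (n : ℂ⟦X⟧) * B = -(X ^ (n + 1) * d⁄dX ℂ A)) (j : ℕ) :
    n * coeff (n + j) B = -(j * coeff j A) := by
  have h1 := congrArg (coeff (n + j)) h
  rwa [← map_natCast C, coeff_C_mul, map_neg, coeff_X_pow_mul_derivative] at h1

theorem coeff_of_solution_of_lt {n : ℕ} (hn : 0 < n) {A B : ℂ⟦X⟧}
    (h : (n : ℂ⟦X⟧) * B = -(X ^ (n + 1) * d⁄dX ℂ A)) {i : ℕ} (hi : i < n) : coeff i B = 0 := by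
  have h1 := congrArg (coeff i) h
  have h2 : coeff i (X ^ (n + 1) * d⁄dX ℂ A) = 0 :=
    X_pow_dvd_iff.1 (dvd_mul_right _ _) i (by omega)
  rw [← map_natCast C, coeff_C_mul, map_neg, h2, neg_zero] at h1
  exact (mul_eq_zero.1 h1).resolve_left (by exact_mod_cast hn.ne')

/-- `t d/dt` preserves exponents and `t^n` shifts them by a multiple of `m`. -/
theorem isSeriesInPow_of_solution {n : ℕ} (hn : 0 < n) {A B : ℂ⟦X⟧}
    (h : (n : ℂ⟦X⟧) * B = -(X ^ (n + 1) * d⁄dX ℂ A)) {m : ℕ} (hm : m ∣ n)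
    (hA : IsSeriesInPow m A) : IsSeriesInPow m B := by
  intro i hi
  rcases lt_or_ge i n with hin | hin
  · exact coeff_of_solution_of_lt hn h hin
  · obtain ⟨j, rfl⟩ := Nat.exists_eq_add_of_le hin
    have h1 := coeff_add_of_solution h j
    rw [hA j fun hj => hi (dvd_add hm hj), mul_zero, neg_zero] at h1
    exact (mul_eq_zero.1 h1).resolve_left (by exact_mod_cast hn.ne')

theorem order_of_solution {n k : ℕ} (hn : 0 < n) (hk : 0 < k) {A B : ℂ⟦X⟧}
    (h : (n : ℂ⟦X⟧) * B = -(X ^ (n + 1) * d⁄dX ℂ A)) {c : ℂ} (hA : (A - C c).order = k) :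
    B.order = (n + k : ℕ) := by
  have hn' : (n : ℂ) ≠ 0 := by exact_mod_cast hn.ne'
  obtain ⟨h1, h2⟩ := order_eq_nat.1 hA
  have hc : ∀ j, 0 < j → coeff j (A - C c) = coeff j A := fun j hj => by
    rw [map_sub, coeff_C, if_neg hj.ne', sub_zero]
  rw [order_eq_nat]
  constructor
  · intro h0
    have h3 := coeff_add_of_solution h k
    rw [h0, mul_zero, eq_comm, neg_eq_zero, ← hc k hk] at h3
    exact mul_ne_zero (by exact_mod_cast hk.ne') h1 h3
  · intro i hi
    rcases lt_or_ge i n with hin | hin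
    · exact coeff_of_solution_of_lt hn h hin
    · obtain ⟨j, rfl⟩ := Nat.exists_eq_add_of_le hin
      have h3 := coeff_add_of_solution h j
      have h4 : (j : ℂ) * coeff j A = 0 := by
        rcases Nat.eq_zero_or_pos j with rfl | hj
        · simp
        · rw [← hc j hj, h2 j (by omega), mul_zero]
      rw [h4, neg_zero] at h3
      exact (mul_eq_zero.1 h3).resolve_left hn'

theorem derivX_puiseuxHom_of_solution {n : ℕ} (hn : 0 < n) {A B : ℂ⟦X⟧}
    (h : (n : ℂ⟦X⟧) * B = -(X ^ (n + 1) * d⁄dX ℂ A)) :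
    derivX (puiseuxHom hn A) = puiseuxHom hn B := by
  rw [derivX_puiseuxHom]
  congr 1
  have hn' : (n : ℂ) ≠ 0 := by exact_mod_cast hn.ne'
  have e : (C (-(1 / (n : ℂ))) : ℂ⟦X⟧) * (n : ℂ⟦X⟧) = -1 := by
    rw [← map_natCast C, ← map_mul]
    have : -(1 / (n : ℂ)) * n = -1 := by field_simp
    rw [this, map_neg, map_one]
  linear_combination C (-(1 / (n : ℂ))) * h - B * e

theorem puiseuxHom_mem_solutions {F : MvPolynomial (Fin 2) ℂ} {n : ℕ} (hn : 0 < n) {A B : ℂ⟦X⟧}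
    (h : (n : ℂ⟦X⟧) * B = -(X ^ (n + 1) * d⁄dX ℂ A))
    (hF : MvPolynomial.aeval ![A, B] F = 0) {c : ℂ} (hA : constantCoeff A = c) :
    puiseuxHom hn A ∈ solutions F c := by
  refine ⟨⟨n, hn, hasDenominator_puiseuxHom hn A⟩, ?_, hasValueAtInfinity_puiseuxHom hn hA, ?_⟩
  · rw [derivX_puiseuxHom_of_solution hn h, ← map_aeval_pair, hF, map_zero]
  · rw [derivX_puiseuxHom_of_solution hn h]
    refine hasValueAtInfinity_puiseuxHom hn ?_
    rw [← coeff_zero_eq_constantCoeff_apply]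
    exact coeff_of_solution_of_lt hn h hn

theorem C_mem_solutions {F : MvPolynomial (Fin 2) ℂ} {y₀ : ℂ}
    (hy₀ : MvPolynomial.eval ![y₀, 0] F = 0) : HahnSeries.C y₀ ∈ solutions F y₀ := by
  rw [← puiseuxHom_C Nat.one_pos]
  refine puiseuxHom_mem_solutions Nat.one_pos (B := 0) (by simp) ?_ (by simp)
  have h := map_aeval_pair (Algebra.ofId ℂ ℂ⟦X⟧) y₀ 0 F
  have h0 : MvPolynomial.aeval ![y₀, 0] F = 0 := by
    rw [MvPolynomial.aeval_def]
    exact hy₀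
  rw [h0, map_zero] at h
  exact h.symm

theorem subst_C_add_X_pow {s : ℂ⟦X⟧} (hs : X ∣ s) (y₀ : ℂ) (k : ℕ) :
    (subst s (C y₀ + X ^ k : ℂ⟦X⟧) : ℂ⟦X⟧) = C y₀ + s ^ k := by
  rw [subst_add (hasSubst_of_X_dvd hs), subst_pow (hasSubst_of_X_dvd hs),
    subst_X (hasSubst_of_X_dvd hs)]
  congr 1
  exact subst_C _

theorem derivative_C_add (y₀ : ℂ) (f : ℂ⟦X⟧) : d⁄dX ℂ (C y₀ + f) = d⁄dX ℂ f := by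
  rw [map_add, derivative_C, zero_add]

theorem solution_relation_iff {n k : ℕ} {b s : ℂ⟦X⟧} (y₀ : ℂ) :
    (n : ℂ⟦X⟧) * (subst s b : ℂ⟦X⟧) = -(X ^ (n + 1) * d⁄dX ℂ (C y₀ + s ^ k)) ↔
      assocSeries n k b s = 0 := by
  rw [derivative_C_add, assocSeries, eq_neg_iff_add_eq_zero, add_comm]

/-- The first `N` terms of `y₀ + s(x ^ (-1 / n)) ^ k` are those obtained from an approximation
of `s`. -/
theorem firstTermsAtInfinity_eq {n k N : ℕ} (hn : 0 < n) (hN : 0 < N) (hk : 0 < k) (y₀ : ℂ)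
    {s : ℂ⟦X⟧} {s₀ : Polynomial ℂ} (hs : s.order = 1) (h : X ^ (N + 1) ∣ (s₀ : ℂ⟦X⟧) - s)
    (hr : ramificationOrder (puiseuxHom hn (C y₀ + s ^ k)) = n) :
    firstTermsAtInfinity N (puiseuxHom hn (C y₀ + s ^ k)) =
      Polynomial.aeval (HahnSeries.single (1 / (n : ℚ)) (1 : ℂ))
        (firstTerms N
          (((Polynomial.C y₀ + Polynomial.X ^ k).comp s₀ : Polynomial ℂ) : ℂ⟦X⟧)) := by
  have hX := X_dvd_of_order_eq_one hs
  have ho : (s ^ k).order = k := by rw [order_pow, hs, nsmul_one]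
  rw [firstTermsAtInfinity_puiseuxHom hn N hr, puiseuxHom_polynomial, comp_C_add_X_pow,
    Polynomial.coe_add, Polynomial.coe_C, Polynomial.coe_pow]
  rw [firstTerms_congr hN hk ho (X_pow_dvd_pow_sub_pow hX h k)]

/-- Every output of the algorithm at a place is the truncation of a solution. -/
theorem exists_solution_of_mem_placeOutput {F : MvPolynomial (Fin 2) ℂ} (hF : F ≠ 0) {y₀ : ℂ}
    {A : ℂ⟦X⟧ × ℂ⟦X⟧} (hA : IsClassicalPuiseux F (y₀, 0) A) {N : ℕ}
    (hN : F.degreeOf 0 + 1 ≤ N) {w : HahnSeries ℚ ℂ}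
    (hw : w ∈ placeOutput N y₀ (firstTerms N A.1) (firstTerms N A.2)) :
    ∃ y ∈ solutions F y₀, firstTermsAtInfinity N y = w := by
  obtain ⟨a, b⟩ := A
  obtain ⟨⟨-, -, hb0, hab⟩, hirr, k, hk, rfl : a = C y₀ + X ^ k⟩ := hA
  simp only at hb0 hab hw
  have hN0 : 0 < N := by omega
  obtain ⟨n, hn, hnk, s₀, hs₀, rfl⟩ := hw
  rw [firstTerms_C_add_X_pow hN0 hk, firstTerms_of_constantCoeff_eq_zero N hb0] at *
  rw [add_sub_cancel_left, Polynomial.natTrailingDegree_X_pow] at hnk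
  -- For `b = 0` the trailing degree is `0` by convention, and the check would read `-n = k` with
  -- `n, k > 0`.
  have hb : b ≠ 0 := by
    rintro rfl
    simp at hnk
    omega
  have hr : b.order = b.order.toNat := (coe_toNat_order hb).symm
  rw [natTrailingDegree_trunc hr (by omega)] at hnk hs₀
  have hrn : b.order.toNat = n + k := by omega
  rw [hrn] at hs₀ hr
  have hle : n + k ≤ F.degreeOf 0 := order_le_degreeOf hF hab hirr (by omega) hr
  obtain ⟨hX₀, hspec⟩ := newtonApprox_spec hs₀
  obtain ⟨h1, hres⟩ := hspec hN0
  have hX : X ∣ (s₀ : ℂ⟦X⟧) := by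
    rw [← pow_one (X : ℂ⟦X⟧), ← polynomial_X_pow_dvd_iff, pow_one]
    exact hX₀
  rw [polynomial_X_pow_dvd_iff, coe_assocResidual n k y₀ hX] at hres
  -- Replacing the truncated `b` by `b` changes the residual only from `t^(r+N)` on.
  have hres' : X ^ (n + k + N) ∣ assocSeries n k b s₀ := by
    refine X_pow_dvd_of_sub (X_pow_dvd_assocSeries_sub hX ?_) hres
    rw [← neg_sub, dvd_neg]
    exact X_pow_dvd_sub_trunc _ _
  obtain ⟨s, hs, hss⟩ := exists_assocSeries_eq_zero hk (by omega) hX (X_pow_dvd_of_order hr)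
    (by rwa [Polynomial.coeff_coe]) hres'
  have hsX := X_dvd_of_X_pow_dvd_sub hss hX
  have hs1 : s.order = 1 := by
    refine order_eq_one_iff.2 ⟨hsX, ?_⟩
    rwa [coeff_eq_of_X_pow_dvd_sub hss (by omega), Polynomial.coeff_coe]
  have hsol := (solution_relation_iff (n := n) (k := k) (b := b) (s := s) y₀).2 hs
  -- A smaller ramification order would make `y₀ + s^k`, and with it `b(s)`, a series in `t^m` for
  -- some `m > 1` dividing `n`, contradicting irreducibility of the place.
  have hram : ramificationOrder (puiseuxHom hn (C y₀ + s ^ k)) = n := by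
    refine ramificationOrder_puiseuxHom hn fun m hm hmn hser => ?_
    exact hirr ⟨m, hm, (C y₀ + s ^ k, subst s b), ⟨s, hs1, subst_C_add_X_pow hsX y₀ k, rfl⟩,
      hser, isSeriesInPow_of_solution hn hsol hmn hser⟩
  refine ⟨puiseuxHom hn (C y₀ + s ^ k), puiseuxHom_mem_solutions hn hsol ?_ ?_, ?_⟩
  · rw [← subst_C_add_X_pow hsX y₀ k, aeval_subst hsX, hab, subst_zero_of_X_dvd hsX]
  · simp [X_dvd_iff.1 hsX, hk.ne']
  · refine firstTermsAtInfinity_eq hn hN0 hk y₀ hs1 ?_ hram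
    rw [← neg_sub, dvd_neg]
    exact hss

/-- The truncation of every nonconstant solution is found by the algorithm at a place. -/
theorem exists_mem_placeOutput_of_solution {F : MvPolynomial (Fin 2) ℂ} {y₀ : ℂ}
    {R : Set (ℂ⟦X⟧ × ℂ⟦X⟧)} (hR : IsRepresentativeSet F (y₀, 0) R) {N : ℕ} (hN : 0 < N)
    {y : HahnSeries ℚ ℂ} (hy : y ∈ solutions F y₀) (hne : y ≠ HahnSeries.C y₀) :
    ∃ A ∈ R, firstTermsAtInfinity N y ∈
      placeOutput N y₀ (firstTerms N A.1) (firstTerms N A.2) := by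
  obtain ⟨hP, hFy, hval, -⟩ := hy
  obtain ⟨hn, hden⟩ := ramificationOrder_spec hP
  obtain ⟨n, hn_eq⟩ : ∃ n, ramificationOrder y = n := ⟨_, rfl⟩
  rw [hn_eq] at hn hden
  obtain ⟨Y, hY0, rfl⟩ := exists_eq_puiseuxHom hn hden hval
  have hnC : (n : ℂ) ≠ 0 := by exact_mod_cast hn.ne'
  have hYne : Y - C y₀ ≠ 0 := fun h => hne (by rw [sub_eq_zero.1 h, puiseuxHom_C])
  obtain ⟨k, hk⟩ : ∃ k : ℕ, (Y - C y₀).order = k := ⟨_, (coe_toNat_order hYne).symm⟩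
  have hk0 : 0 < k := by
    rw [Nat.pos_iff_ne_zero]
    rintro rfl
    refine (order_eq_nat.1 hk).1 ?_
    simp [hY0]
  obtain ⟨S, hS, hSk⟩ := exists_pow_eq hk0 hk
  set B : ℂ⟦X⟧ := C (-(1 / (n : ℂ))) * (X ^ (n + 1) * d⁄dX ℂ Y) with hB
  have hsol : (n : ℂ⟦X⟧) * B = -(X ^ (n + 1) * d⁄dX ℂ Y) := by
    have e : (n : ℂ⟦X⟧) * C (-(1 / (n : ℂ))) = -1 := by
      rw [← map_natCast C, ← map_mul]
      have : (n : ℂ) * -(1 / (n : ℂ)) = -1 := by field_simp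
      rw [this, map_neg, map_one]
    rw [hB, ← mul_assoc, e, neg_one_mul]
  have hFYB : MvPolynomial.aeval ![Y, B] F = 0 := by
    apply puiseuxHom_injective hn
    rw [map_aeval_pair, map_zero, ← derivX_puiseuxHom_of_solution hn hsol, hFy]
  have hdY : d⁄dX ℂ Y ≠ 0 := by
    intro h
    have h1 := coeff_X_mul_derivative Y k
    rw [h, mul_zero, map_zero, eq_comm] at h1
    have h2 := (order_eq_nat.1 hk).1
    rw [map_sub, coeff_C, if_neg hk0.ne', sub_zero] at h2
    exact mul_ne_zero (by exact_mod_cast hk0.ne') h2 h1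
  have hirr : IsIrreducible (Y, B) := isIrreducible_of_solution hdY hsol fun m hm hmn =>
    not_isSeriesInPow_of_ramificationOrder hn hn_eq hm hmn
  -- The inverse of the `k`-th root `S` of `Y - y₀` puts `(Y, B)` into classical Puiseux form.
  obtain ⟨v, hv, hvS, hSv⟩ := exists_subst_inverse hS
  have hvX := X_dvd_of_order_eq_one hv
  have hYS : Y = C y₀ + S ^ k := by rw [hSk]; ring
  have hvY : (subst v Y : ℂ⟦X⟧) = C y₀ + X ^ k := by
    rw [hYS, subst_add (hasSubst_of_X_dvd hvX), subst_pow (hasSubst_of_X_dvd hvX), hvS]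
    congr 1
    exact subst_C _
  have heq : Equivalent (Y, B) (C y₀ + X ^ k, subst v B) := ⟨v, hv, hvY, rfl⟩
  have hclass : IsClassicalPuiseux F (y₀, 0) (C y₀ + X ^ k, subst v B) := by
    refine ⟨⟨?_, ?_, ?_, ?_⟩, hirr.of_equivalent heq.symm, k, hk0, rfl⟩
    · rintro ⟨c, d, h⟩
      have h1 := congrArg (coeff k) (congrArg Prod.fst h)
      simp [coeff_C, hk0.ne', coeff_X_pow] at h1
    · simp [hk0.ne']
    · change constantCoeff (subst v B : ℂ⟦X⟧) = 0
      rw [constantCoeff_subst_of_X_dvd hvX, ← coeff_zero_eq_constantCoeff_apply]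
      exact coeff_of_solution_of_lt hn hsol hn
    · have h1 := aeval_subst hvX Y B F
      rwa [hFYB, subst_zero_of_X_dvd hvX, hvY] at h1
  obtain ⟨⟨a, b⟩, ⟨hAR, hAeq⟩, -⟩ := hR.2 _ hclass
  obtain ⟨⟨-, -, hb0, -⟩, -, k', hk'0, rfl : a = C y₀ + X ^ k'⟩ := hR.1 _ hAR
  -- Passing from the representative back to `(Y, B)` yields the series `s` that solves the
  -- associated equation.
  obtain ⟨s, hs, hsa, hsb⟩ := hAeq.trans heq.symm
  simp only at hb0
  have hsX := X_dvd_of_order_eq_one hs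
  replace hsa : C y₀ + s ^ k' = Y := (subst_C_add_X_pow hsX y₀ k').symm.trans hsa
  replace hsb : (subst s b : ℂ⟦X⟧) = B := hsb
  obtain rfl : k' = k := by
    have h1 : s ^ k' = Y - C y₀ := by rw [← hsa]; ring
    rw [← h1, order_pow, hs, nsmul_one] at hk
    exact_mod_cast hk
  have hbord : b.order = (n + k' : ℕ) := by
    rw [← order_subst hs, hsb]
    exact order_of_solution hn hk0 hsol hk
  have hassoc : assocSeries n k' b s = 0 := by
    rw [← solution_relation_iff y₀, hsa, hsb]
    exact hsol
  refine ⟨_, hAR, ?_⟩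
  change _ ∈ placeOutput N y₀ (firstTerms N (C y₀ + X ^ k')) (firstTerms N b)
  have hbN : b.order.toNat = n + k' := by rw [hbord]; rfl
  rw [firstTerms_C_add_X_pow hN hk0, firstTerms_of_constantCoeff_eq_zero N hb0, hbN]
  have htd := natTrailingDegree_trunc hbord (j := n + k' + N) (by omega)
  have hbd := X_pow_dvd_sub_trunc (n + k' + N) b
  refine ⟨n, hn, ?_, trunc (N + 1) s, ?_, ?_⟩
  · rw [add_sub_cancel_left, Polynomial.natTrailingDegree_X_pow, htd]
    push_cast
    ring
  · rw [htd]
    refine trunc_mem_newtonApprox hk0 y₀ ?_ hs ?_ le_rfl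
    · exact X_pow_dvd_of_sub ((pow_dvd_pow X (by omega)).trans hbd) (X_pow_dvd_of_order hbord)
    · exact X_pow_dvd_of_sub (X_pow_dvd_assocSeries_sub hsX hbd) (by rw [hassoc]; exact dvd_zero _)
  · rw [← hsa] at hn_eq ⊢
    exact firstTermsAtInfinity_eq hn hN hk0 y₀ hs (X_pow_dvd_sub_trunc (N + 1) s) hn_eq

end PuiseuxAtInfinity

theorem mainTheorem6 (F : MvPolynomial (Fin 2) ℂ) (hF : Squarefree F)
    (hFy : ∀ g : Polynomial ℂ,
      Polynomial.aeval (MvPolynomial.X 0 : MvPolynomial (Fin 2) ℂ) g ∣ F → g.natDegree = 0)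
    (hFp : ∀ g : Polynomial ℂ,
      Polynomial.aeval (MvPolynomial.X 1 : MvPolynomial (Fin 2) ℂ) g ∣ F → g.natDegree = 0)
    (y₀ : ℂ) (hy₀ : MvPolynomial.eval ![y₀, 0] F = 0)
    (R : Set (PowerSeries ℂ × PowerSeries ℂ))
    (hR : PuiseuxAtInfinity.IsRepresentativeSet F (y₀, 0) R) :
    (∀ w ∈ PuiseuxAtInfinity.algorithmOutput F y₀ R,
      ∃ y ∈ PuiseuxAtInfinity.solutions F y₀,
        PuiseuxAtInfinity.firstTermsAtInfinity (PuiseuxAtInfinity.termBound F) y = w) ∧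
    (∀ y ∈ PuiseuxAtInfinity.solutions F y₀,
      ∃ w ∈ PuiseuxAtInfinity.algorithmOutput F y₀ R,
        PuiseuxAtInfinity.firstTermsAtInfinity (PuiseuxAtInfinity.termBound F) y = w) := by
  -- The entry `deg_y F + 1` of the maximum already puts the resonance at exponent `n + 1` within
  -- the first `N` terms.
  have hN : F.degreeOf 0 + 1 ≤ PuiseuxAtInfinity.termBound F := le_max_right _ _
  constructor
  · rintro w (hw | hw)
    · rw [Set.mem_singleton_iff] at hw
      subst hw
      exact ⟨_, PuiseuxAtInfinity.C_mem_solutions hy₀,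
        PuiseuxAtInfinity.firstTermsAtInfinity_C _ _⟩
    · obtain ⟨_, ⟨A, hA, rfl⟩, hw⟩ := Set.mem_iUnion₂.1 hw
      exact PuiseuxAtInfinity.exists_solution_of_mem_placeOutput hF.ne_zero (hR.1 A hA) hN hw
  · intro y hy
    refine ⟨_, ?_, rfl⟩
    by_cases hc : y = HahnSeries.C y₀
    · left
      rw [hc, PuiseuxAtInfinity.firstTermsAtInfinity_C]
      rfl
    · obtain ⟨A, hA, hmem⟩ :=
        PuiseuxAtInfinity.exists_mem_placeOutput_of_solution hR (Nat.succ_pos _ |>.trans_le hN) hy hc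
      exact Or.inr (Set.mem_iUnion₂.2 ⟨_, ⟨A, hA, rfl⟩, hmem⟩)
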